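/- Let $N\ge 1$ and $d_1,\dots,d_N$ be integers, let $h^{(j)}:\mathbb{R}^{d_1}\times\cdots\times\mathbb{R}^{d_N}\to\mathbb{R}^{d_j}$, and let the random sequences $x^{(j)}_n\in\mathbb{R}^{d_j}$ on a probability space satisfy, for $1\le j\le N$ and $n\ge 0$, $$x^{(j)}_{n+1}=x^{(j)}_n+\alpha^{(j)}_n\bigl(h^{(j)}(x^{(1)}_n,\dots,x^{(N)}_n)+M^{(j)}_{n+1}\bigr).$$ Assume: (A:1) every $h^{(j)}$ is Lipschitz continuous. (A:2) For each $j$, $\{M^{(j)}_{n+1}\}_{n\ge0}$ is a martingale difference sequence with respect to $\mathcal{F}_n=\sigma(x^{(k)}_i,\,0\le i\le n;\ M^{(k)}_i,\,1\le i\le n;\ 1\le k\le N)$, that is, $M^{(j)}_{n+1}$ is integrable with $\mathbb{E}[M^{(j)}_{n+1}\mid\mathcal{F}_n]=0$ a.s., and for constants $K^{(j)}>0$, $\mathbb{E}[\|M^{(j)}_{n+1}\|^2\mid\mathcal{F}_n]\le K^{(j)}\bigl(1+\sum_{k=1}^N\|x^{(k)}_n\|^2\bigr)$ a.s. for all $n\ge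 0$. (A:3) The step sizes are deterministic with $\alpha^{(j)}_n>0$, $\sum_n\alpha^{(j)}_n=\infty$ for all $j$, $\sum_n\sum_{j=1}^N(\alpha^{(j)}_n)^2<\infty$, and $\alpha^{(j)}_n/\alpha^{(j-1)}_n\to0$ as $n\to\infty$ for $1<j\le N$. An equilibrium $e$ of an ODE $\dot x=f(x)$ is called globally asymptotically stable if solutions on $[0,\infty)$ exist for all initial values, $e$ is Lyapunov stable, and every solution on $[0,\infty)$ converges to $e$. Such an $e$ is the only equilibrium. Given maps $\lambda^{(j)}:\mathbb{R}^{d_{j+1}}\times\cdots\times\mathbb{R}^{d_N}\to\mathbb{R}^{d_j}$ (for $j=N$: a point of $\mathbb{R}^{d_N}$), an index $i$, and $(x^{(i)},\dots,x^{(N)})$, let $Y^{(i)}_\lambda(x^{(i)},\dots,x^{(N)})=(y^{(1)},\dots,y^{(N)})$, where $y^{(j)}=x^{(j)}$ for $j\ge i$ and, recursively for $j=i-1,i-2,\dots,1$, $y^{(j)}=\lambda^{(j)}(y^{(j+1)},\dots,y^{(N)})$. (B.N.i), $1\le i\le N$: there are functions $h^{(i)}_\infty$ and Lipschitz maps $\lambda^{(i)}_\infty:\mathbb{R}^{d_{i+1}}\times\cdots\times\mathbb{R}^{d_N}\to\mathbb{R}^{d_i}$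 with $\lambda^{(i)}_\infty(0,\dots,0)=0$ (for $i=N$ this means $\lambda^{(N)}_\infty=0\in\mathbb{R}^{d_N}$) such that, as $c\to\infty$, the functions $$h^{(i)}_c(x^{(i)},\dots,x^{(N)})=\frac1c\,h^{(i)}\bigl(c\,Y^{(i)}_{\lambda_\infty}(x^{(i)},\dots,x^{(N)})\bigr),\qquad c\ge1,$$ converge to $h^{(i)}_\infty$ uniformly on compact sets, and, for all fixed $x^{(i+1)},\dots,x^{(N)}$, the ODE $\dot x^{(i)}(t)=h^{(i)}_\infty(x^{(i)}(t),x^{(i+1)},\dots,x^{(N)})$ has $\lambda^{(i)}_\infty(x^{(i+1)},\dots,x^{(N)})$ as its unique globally asymptotically stable equilibrium. (C.N.i), $1\le i\le N$: there are maps $\lambda^{(i)}:\mathbb{R}^{d_{i+1}}\times\cdots\times\mathbb{R}^{d_N}\to\mathbb{R}^{d_i}$ (for $i=N$: a point $x^{(N)}_*\in\mathbb{R}^{d_N}$) such that, for all fixed $x^{(i+1)},\dots,x^{(N)}$, the ODE $\dot x^{(i)}(t)=h^{(i)}\bigl(Y^{(i)}_{\lambda}(x^{(i)}(t),x^{(i+1)},\dots,x^{(N)})\bigr)$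 has $\lambda^{(i)}(x^{(i+1)},\dots,x^{(N)})$ as a globally asymptotically stable equilibrium. Then, almost surely, $$\sup_{n\ge0}\Bigl(\|x^{(1)}_n\|+\|x^{(2)}_n\|+\cdots+\|x^{(N)}_n\|\Bigr)<\infty.$$ -/

import Mathlib

open MeasureTheory Filter Topology
open scoped NNReal ENNReal

section NTimescale

/-- Tuples `(x⁽¹⁾, …, x⁽ᴺ⁾)` with `x⁽ʲ⁾ ∈ ℝ^{d j}`, indexed by `Fin N`. -/
abbrev NState {N : ℕ} (d : Fin N → ℕ) : Type :=
  (j : Fin N) → EuclideanSpace ℝ (Fin (d j))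

/-- Tuples `(x⁽ⁱ⁾, x⁽ⁱ⁺¹⁾, …, x⁽ᴺ⁾)`. -/
abbrev NFrom {N : ℕ} (d : Fin N → ℕ) (i : Fin N) : Type :=
  (j : {j : Fin N // i ≤ j}) → EuclideanSpace ℝ (Fin (d j.1))

/-- Tuples `(x⁽ⁱ⁺¹⁾, …, x⁽ᴺ⁾)`; for the last index this is a one-point space, and a function
on it is just a point. -/
abbrev NAbove {N : ℕ} (d : Fin N → ℕ) (i : Fin N) : Type :=
  (j : {j : Fin N // i < j}) → EuclideanSpace ℝ (Fin (d j.1))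

/-- The tuple `(u, p⁽ⁱ⁺¹⁾, …, p⁽ᴺ⁾)`. -/
def NFrom.cons {N : ℕ} {d : Fin N → ℕ} (i : Fin N) (u : EuclideanSpace ℝ (Fin (d i)))
    (p : NAbove d i) : NFrom d i :=
  fun j => if h : i = j.1 then h ▸ u else p ⟨j.1, lt_of_le_of_ne j.2 h⟩

theorem NFrom.cons_self {N : ℕ} {d : Fin N → ℕ} (i : Fin N)
    (u : EuclideanSpace ℝ (Fin (d i))) (p : NAbove d i) :
    NFrom.cons i u p ⟨i, le_refl i⟩ = u := by
  simp [NFrom.cons]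

theorem NFrom.cons_of_lt {N : ℕ} {d : Fin N → ℕ} (i : Fin N)
    (u : EuclideanSpace ℝ (Fin (d i))) (p : NAbove d i) (j : Fin N) (h : i < j) :
    NFrom.cons i u p ⟨j, h.le⟩ = p ⟨j, h⟩ := by
  simp [NFrom.cons, h.ne]

/-- The full tuple obtained from `y = (y⁽ⁱ⁾, …, y⁽ᴺ⁾)` by filling in the indices `j < i`
downwards: `y⁽ʲ⁾ = lam⁽ʲ⁾ (y⁽ʲ⁺¹⁾, …, y⁽ᴺ⁾)` for `j = i - 1, i - 2, …, 1`. -/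
noncomputable def cascade {N : ℕ} {d : Fin N → ℕ}
    (lam : (i : Fin N) → NAbove d i → EuclideanSpace ℝ (Fin (d i)))
    (i : Fin N) (y : NFrom d i) (j : Fin N) : EuclideanSpace ℝ (Fin (d j)) :=
  if h : i ≤ j then y ⟨j, h⟩ else lam j (fun k => cascade lam i y k.1)
termination_by N - j.1
decreasing_by
  have _h1 : j.1 < k.1.1 := k.2
  have _h2 := k.1.2
  omega

/-- The scaled function
`h_c⁽ⁱ⁾ (x⁽ⁱ⁾, …, x⁽ᴺ⁾) = h⁽ⁱ⁾ (c y⁽¹⁾, …, c y⁽ᴺ⁾) / c`, where `y⁽ʲ⁾ = x⁽ʲ⁾` for `j ≥ i` and the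
`y⁽ʲ⁾` with `j < i` are filled in through `lamInf`. -/
noncomputable def scaledDrift {N : ℕ} {d : Fin N → ℕ}
    (h : (j : Fin N) → NState d → EuclideanSpace ℝ (Fin (d j)))
    (lamInf : (i : Fin N) → NAbove d i → EuclideanSpace ℝ (Fin (d i)))
    (i : Fin N) (c : ℝ) (y : NFrom d i) : EuclideanSpace ℝ (Fin (d i)) :=
  c⁻¹ • h i (fun j => c • cascade lamInf i y j)

/-- `e` is a globally asymptotically stable equilibrium of the autonomous ODE `ẋ = f x`:
it is an equilibrium, every initial condition has a solution on `[0, ∞)`, `e` is Lyapunov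
stable, and all solutions converge to `e`. (Solutions exist automatically if `f` is Lipschitz.) -/
structure IsGASEquilibrium {E : Type*} [NormedAddCommGroup E] [NormedSpace ℝ E]
    (f : E → E) (e : E) : Prop where
  equilibrium : f e = 0
  exists_solution : ∀ x₀ : E, ∃ x : ℝ → E, x 0 = x₀ ∧
    IsIntegralCurveOn x (fun _ => f) (Set.Ici 0)
  stable : ∀ ε > 0, ∃ δ > 0, ∀ x : ℝ → E, IsIntegralCurveOn x (fun _ => f) (Set.Ici 0) →
    ‖x 0 - e‖ < δ → ∀ t ≥ 0, ‖x t - e‖ < ε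
  attractive : ∀ x : ℝ → E, IsIntegralCurveOn x (fun _ => f) (Set.Ici 0) →
    Tendsto x atTop (𝓝 e)

/-- A globally asymptotically stable equilibrium is the only equilibrium. -/
theorem IsGASEquilibrium.eq_of_equilibrium {E : Type*} [NormedAddCommGroup E]
    [NormedSpace ℝ E] {f : E → E} {e e' : E} (he : IsGASEquilibrium f e) (h0 : f e' = 0) :
    e' = e := by
  have h := he.attractive (fun _ => e') (fun t _ => by
    simpa [h0] using hasDerivWithinAt_const t (Set.Ici (0 : ℝ)) e')
  exact tendsto_nhds_unique tendsto_const_nhds h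

/-- The sigma-field `ℱ_n = σ(x⁽ʲ⁾_i, M⁽ʲ⁾_i : i ≤ n, 1 ≤ j ≤ N)`. The noise starts at time
`1`; the value `M 0` plays no role. -/
def history {N : ℕ} {d : Fin N → ℕ} {Ω : Type*} (x M : ℕ → Ω → NState d) (n : ℕ) :
    MeasurableSpace Ω :=
  (⨆ i : ℕ, ⨆ (_ : i ≤ n), ⨆ j : Fin N,
      MeasurableSpace.comap (fun ω => x i ω j) inferInstance) ⊔
    ⨆ i : ℕ, ⨆ (_ : 1 ≤ i ∧ i ≤ n), ⨆ j : Fin N,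
      MeasurableSpace.comap (fun ω => M i ω j) inferInstance

/-- The sequences `M⁽ʲ⁾_{n+1}` are martingale differences with respect to `ℱ_n`, and
`𝔼[‖M⁽ʲ⁾_{n+1}‖² | ℱ_n] ≤ K⁽ʲ⁾ (1 + ∑ₖ ‖x⁽ᵏ⁾_n‖²)` almost surely, with constants `K⁽ʲ⁾ > 0`. The
conditional expectation of the nonnegative variable `‖M⁽ʲ⁾_{n+1}‖²` is the `[0, ∞]`-valued one. -/
structure IsMartingaleNoise {N : ℕ} {d : Fin N → ℕ} {Ω : Type*} [MeasurableSpace Ω]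
    (μ : Measure Ω) (x M : ℕ → Ω → NState d) (K : Fin N → ℝ) : Prop where
  measurable : ∀ n j, Measurable (fun ω => M (n + 1) ω j)
  integrable : ∀ n j, Integrable (fun ω => M (n + 1) ω j) μ
  condExp_eq_zero : ∀ n j, μ[fun ω => M (n + 1) ω j | history x M n] =ᵐ[μ] 0
  const_pos : ∀ j, 0 < K j
  condLExp_le : ∀ n j, ∀ᵐ ω ∂μ,
    condLExp (history x M n) μ (fun ω => ‖M (n + 1) ω j‖ₑ ^ 2) ω ≤
      ENNReal.ofReal (K j * (1 + ∑ k, ‖x n ω k‖ ^ 2))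

/-- Step-size schedules on `N` timescales; a larger index means a slower timescale. -/
structure IsStepSizes {N : ℕ} (α : Fin N → ℕ → ℝ) : Prop where
  pos : ∀ j n, 0 < α j n
  sum_eq_top : ∀ j, Tendsto (fun n => ∑ k ∈ Finset.range n, α j k) atTop atTop
  summable_sq : Summable (fun n => ∑ j, α j n ^ 2)
  ratio : ∀ j k : Fin N, (j : ℕ) + 1 = k → Tendsto (fun n => α k n / α j n) atTop (𝓝 0)

/-- The condition on the scaled ODE of the `i`-th timescale. For the last index, `lamInf i` is a
point, and the last two fields say that this point is the origin of `ℝ^{d i}`. -/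
structure ScaledCondition {N : ℕ} {d : Fin N → ℕ}
    (h : (j : Fin N) → NState d → EuclideanSpace ℝ (Fin (d j)))
    (hInf : (i : Fin N) → NFrom d i → EuclideanSpace ℝ (Fin (d i)))
    (lamInf : (i : Fin N) → NAbove d i → EuclideanSpace ℝ (Fin (d i)))
    (i : Fin N) : Prop where
  limit : ∀ S : Set (NFrom d i), IsCompact S →
    TendstoUniformlyOn (fun (c : ℝ) y => scaledDrift h lamInf i c y) (hInf i) atTop S
  gas : ∀ p : NAbove d i,
    IsGASEquilibrium (fun u => hInf i (NFrom.cons i u p)) (lamInf i p)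
  lipschitz : ∃ L : ℝ≥0, LipschitzWith L (lamInf i)
  map_zero : lamInf i 0 = 0

/-- The condition on the unscaled ODE of the `i`-th timescale. For the last index, `lam i` is a
point `x⁽ᴺ⁾_*`. -/
def LimitCondition {N : ℕ} {d : Fin N → ℕ}
    (h : (j : Fin N) → NState d → EuclideanSpace ℝ (Fin (d j)))
    (lam : (i : Fin N) → NAbove d i → EuclideanSpace ℝ (Fin (d i)))
    (i : Fin N) : Prop :=
  ∀ p : NAbove d i,
    IsGASEquilibrium (fun u => h i (cascade lam i (NFrom.cons i u p))) (lam i p)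

end NTimescale

/-! The iterates are compared with their running bound `R n`, the maximum of `1` and of the norms up
to time `n`. Rescaling by the bound at the end of a time window, not at its start, keeps the whole
window in the unit ball, so no growth estimate is needed.

Noise: dividing by `R k`, which is `ℱ_k`-measurable, turns the quadratic variance bound into a
constant one. The weighted normalized noise is therefore summable almost surely, and Abel summation
gives partial sums of the original noise of size at most `ε * R q`
(`IsMartingaleNoise.ae_norm_sum_le`). The rest is deterministic.

Tracking: for late `n` and every large scale `ρ ≥ R n`, the point `ρ⁻¹ • x n` is close to the graph
of each `lamInf i` (`IsPerturbedScheme.tracksGraph`), by induction from the fastest timescale. Over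
a backward window of bounded length in timescale `i`, the slower components hardly move and the
faster ones already follow their graphs. Component `i` is then a perturbed Euler scheme for the
limiting ODE with frozen parameters, which is attracted to its equilibrium
(`IsGASEquilibrium.exists_euler_tracking`).

Conclusion: since `lamInf i 0 = 0`, being close to all the graphs forces a small norm. If `R` became
too large, its value would be the norm of a late iterate, whose rescaling has norm exactly `1`: a
contradiction (`IsPerturbedScheme.bddAbove_norm`). -/

/-! ### Summation by parts and discrete Grönwall. -/

/-- Abel summation: a nonnegative nondecreasing weight multiplies the size of the partial sums by
at most its last value. -/
theorem norm_sum_Ico_smul_le_of_monotone {E : Type*} [NormedAddCommGroup E] [NormedSpace ℝ E]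
    {R : ℕ → ℝ} (hR : Monotone R) (hR0 : ∀ n, 0 ≤ R n) {v : ℕ → E} {ε : ℝ} {a b : ℕ}
    (hab : a ≤ b) (hv : ∀ k, a ≤ k → k ≤ b → ‖∑ i ∈ Finset.Ico k b, v i‖ ≤ ε) :
    ‖∑ k ∈ Finset.Ico a b, R k • v k‖ ≤ ε * R b := by
  -- The difference is the sum of the increments `R (k + 1) - R k` times tail sums; the increments
  -- are nonnegative and telescope.
  have key : ‖∑ k ∈ Finset.Ico a b, R k • v k - R a • ∑ k ∈ Finset.Ico a b, v k‖
      ≤ ε * (R b - R a) := by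
    clear hR0
    induction hab using Nat.decreasingInduction with
    | self => simp
    | of_succ k hk ih =>
      have ih' := ih (fun i h1 h2 => hv i (by omega) h2)
      have h3 := hv (k + 1) (by omega) hk
      rw [Finset.sum_eq_sum_Ico_succ_bot hk, Finset.sum_eq_sum_Ico_succ_bot hk]
      have e : R k • v k + ∑ i ∈ Finset.Ico (k + 1) b, R i • v i
            - R k • (v k + ∑ i ∈ Finset.Ico (k + 1) b, v i)
          = (∑ i ∈ Finset.Ico (k + 1) b, R i • v i
              - R (k + 1) • ∑ i ∈ Finset.Ico (k + 1) b, v i)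
            + (R (k + 1) - R k) • ∑ i ∈ Finset.Ico (k + 1) b, v i := by
        module
      rw [e]
      have h4 : 0 ≤ R (k + 1) - R k := sub_nonneg.2 (hR (Nat.le_succ k))
      calc _ ≤ _ := norm_add_le _ _
        _ ≤ ε * (R b - R (k + 1)) + (R (k + 1) - R k) * ε := by
            rw [norm_smul, Real.norm_of_nonneg h4]
            gcongr
        _ = _ := by ring
  calc ‖∑ k ∈ Finset.Ico a b, R k • v k‖
      ≤ ‖∑ k ∈ Finset.Ico a b, R k • v k - R a • ∑ k ∈ Finset.Ico a b, v k‖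
        + ‖R a • ∑ k ∈ Finset.Ico a b, v k‖ := by
          simpa using norm_add_le (∑ k ∈ Finset.Ico a b, R k • v k
            - R a • ∑ k ∈ Finset.Ico a b, v k) (R a • ∑ k ∈ Finset.Ico a b, v k)
    _ ≤ ε * (R b - R a) + R a * ε := by
          rw [norm_smul, Real.norm_of_nonneg (hR0 a)]
          have := hv a le_rfl hab
          have := hR0 a
          gcongr
    _ = _ := by ring

/-- Discrete Grönwall inequality in summed form. -/
theorem le_mul_exp_sum_of_le_add_sum {D c : ℕ → ℝ} {B : ℝ} {m n : ℕ} (hB : 0 ≤ B) (hmn : m ≤ n)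
    (hc : ∀ k, m ≤ k → k < n → 0 ≤ c k)
    (hD : ∀ k, m ≤ k → k ≤ n → D k ≤ B + ∑ i ∈ Finset.Ico m k, c i * D i) :
    D n ≤ B * Real.exp (∑ i ∈ Finset.Ico m n, c i) := by
  -- The induction runs on the majorant, since a bound on `D k` alone would not propagate.
  have key : ∀ k, m ≤ k → k ≤ n →
      B + ∑ i ∈ Finset.Ico m k, c i * D i ≤ B * Real.exp (∑ i ∈ Finset.Ico m k, c i) := by
    intro k hk
    induction k, hk using Nat.le_induction with
    | base => simp
    | succ k hk ih =>
      intro hkn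
      have ih' := ih (by omega)
      have hck := hc k hk hkn
      have hDk := (hD k hk (by omega)).trans ih'
      rw [Finset.sum_Ico_succ_top hk, Finset.sum_Ico_succ_top hk, Real.exp_add]
      calc B + (∑ i ∈ Finset.Ico m k, c i * D i + c k * D k)
          = (B + ∑ i ∈ Finset.Ico m k, c i * D i) + c k * D k := by ring
        _ ≤ B * Real.exp (∑ i ∈ Finset.Ico m k, c i)
            + c k * (B * Real.exp (∑ i ∈ Finset.Ico m k, c i)) := by gcongr
        _ = B * Real.exp (∑ i ∈ Finset.Ico m k, c i) * (c k + 1) := by ring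
        _ ≤ B * Real.exp (∑ i ∈ Finset.Ico m k, c i) * Real.exp (c k) := by
            gcongr
            exact Real.add_one_le_exp _
        _ = _ := by ring
  exact (hD n hmn le_rfl).trans (key n hmn le_rfl)

/-! ### Lipschitz ODEs with a globally asymptotically stable equilibrium. -/

theorem IsIntegralCurveOn.dist_le_mul_exp {E : Type*} [NormedAddCommGroup E] [NormedSpace ℝ E]
    {f : E → E} {L : ℝ≥0} (hf : LipschitzWith L f) {x y : ℝ → E}
    (hx : IsIntegralCurveOn x (fun _ => f) (Set.Ici 0))
    (hy : IsIntegralCurveOn y (fun _ => f) (Set.Ici 0)) {t : ℝ} (ht : 0 ≤ t) :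
    dist (x t) (y t) ≤ dist (x 0) (y 0) * Real.exp (L * t) := by
  have hcont : ∀ {z : ℝ → E}, IsIntegralCurveOn z (fun _ => f) (Set.Ici 0) →
      ContinuousOn z (Set.Icc 0 t) := fun hz s hs =>
    ((hz s hs.1).continuousWithinAt).mono Set.Icc_subset_Ici_self
  have hder : ∀ {z : ℝ → E}, IsIntegralCurveOn z (fun _ => f) (Set.Ici 0) →
      ∀ s ∈ Set.Ico 0 t, HasDerivWithinAt z (f (z s)) (Set.Ici s) s := fun hz s hs =>
    (hz s hs.1).mono (Set.Ici_subset_Ici.2 hs.1)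
  simpa using dist_le_of_trajectories_ODE (v := fun _ => f) (fun _ => hf) (hcont hx) (hder hx)
    (hcont hy) (hder hy) le_rfl t ⟨ht, le_rfl⟩

theorem IsIntegralCurveOn.comp_add_Ici {E : Type*} [NormedAddCommGroup E] [NormedSpace ℝ E]
    {f : E → E} {x : ℝ → E} (hx : IsIntegralCurveOn x (fun _ => f) (Set.Ici 0)) {T : ℝ}
    (hT : 0 ≤ T) : IsIntegralCurveOn (fun s => x (s + T)) (fun _ => f) (Set.Ici 0) := by
  refine (hx.comp_add T).mono ?_
  intro s hs
  refine ⟨s + T, ?_, by simp⟩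
  have : (0 : ℝ) ≤ s := hs
  simp only [Set.mem_Ici]
  positivity

theorem IsGASEquilibrium.isIntegralCurveOn_const {E : Type*} [NormedAddCommGroup E]
    [NormedSpace ℝ E] {f : E → E} {e : E} (h : IsGASEquilibrium f e) :
    IsIntegralCurveOn (fun _ => e) (fun _ => f) (Set.Ici 0) := fun t _ => by
  simpa [h.equilibrium] using hasDerivWithinAt_const t (Set.Ici (0 : ℝ)) e

/-- Attraction to a globally asymptotically stable equilibrium of a Lipschitz vector field is
uniform over bounded sets of initial values. -/
theorem IsGASEquilibrium.uniform_attraction {E : Type*} [NormedAddCommGroup E]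
    [NormedSpace ℝ E] [ProperSpace E] {f : E → E} {e : E} (h : IsGASEquilibrium f e) {L : ℝ≥0}
    (hf : LipschitzWith L f) (r : ℝ) {δ : ℝ} (hδ : 0 < δ) :
    ∃ T > 0, ∀ x : ℝ → E, IsIntegralCurveOn x (fun _ => f) (Set.Ici 0) → ‖x 0‖ ≤ r →
      ∀ t ≥ T, ‖x t - e‖ < δ := by
  -- A single visit to the `η`-ball around `e` keeps the curve `δ`-close forever, so only an
  -- entrance time has to be made uniform.
  obtain ⟨η, hη, hstab⟩ := h.stable δ hδ
  have hpt : ∀ u : E, ∃ T > 0, ∃ X : ℝ → E, X 0 = u ∧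
      IsIntegralCurveOn X (fun _ => f) (Set.Ici 0) ∧ ‖X T - e‖ < η / 2 := by
    intro u
    obtain ⟨X, hX0, hX⟩ := h.exists_solution u
    have hev : ∀ᶠ t in atTop, ‖X t - e‖ < η / 2 := by
      have := (Metric.tendsto_nhds.1 (h.attractive X hX)) (η / 2) (by positivity)
      simpa only [dist_eq_norm] using this
    obtain ⟨T, hT, hT0⟩ := (hev.and (eventually_gt_atTop 0)).exists
    exact ⟨T, hT0, X, hX0, hX, hT⟩
  choose T hT0 X hX0 hX hXT using hpt
  -- The radii offset the Grönwall factor, so curves starting in the ball around `u` are within `η /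
  -- 2` of `X u` at time `T u`.
  obtain ⟨s, -, hs⟩ := (isCompact_closedBall (0 : E) r).elim_nhds_subcover
    (fun u => Metric.ball u (η / 2 * Real.exp (-(L * T u))))
    (fun u _ => Metric.ball_mem_nhds _ (by positivity))
  refine ⟨∑ u ∈ s, T u + 1, ?_, ?_⟩
  · have : 0 ≤ ∑ u ∈ s, T u := Finset.sum_nonneg fun u _ => (hT0 u).le
    linarith
  · intro x hx hx0 t ht
    have hmem := hs (show x 0 ∈ Metric.closedBall (0 : E) r by simpa using hx0)
    simp only [Set.mem_iUnion] at hmem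
    obtain ⟨u, hu, hxu⟩ := hmem
    have hTt : T u ≤ t := by
      have := Finset.single_le_sum (f := T) (fun u _ => (hT0 u).le) hu
      linarith
    have h1 : dist (x (T u)) (X u (T u)) < η / 2 := by
      refine (hx.dist_le_mul_exp hf (hX u) (hT0 u).le).trans_lt ?_
      rw [hX0 u]
      have h2 : dist (x 0) u < η / 2 * Real.exp (-(L * T u)) := hxu
      calc _ < η / 2 * Real.exp (-(L * T u)) * Real.exp (L * T u) := by gcongr
        _ = η / 2 := by rw [mul_assoc, ← Real.exp_add]; simp
    have h3 : ‖x (T u) - e‖ < η := by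
      calc ‖x (T u) - e‖ = ‖(x (T u) - X u (T u)) + (X u (T u) - e)‖ := by congr 1; abel
        _ ≤ ‖x (T u) - X u (T u)‖ + ‖X u (T u) - e‖ := norm_add_le _ _
        _ < η / 2 + η / 2 := add_lt_add (by rwa [← dist_eq_norm]) (hXT u)
        _ = η := by ring
    have h4 := hstab _ (hx.comp_add_Ici (hT0 u).le) (by simpa using h3) (t - T u)
      (sub_nonneg.2 hTt)
    simpa using h4

/-- The local error of one Euler step along an integral curve of a Lipschitz vector field. -/
theorem IsIntegralCurveOn.norm_euler_step_le {E : Type*} [NormedAddCommGroup E]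
    [NormedSpace ℝ E] {f : E → E} {L : ℝ≥0} (hf : LipschitzWith L f) {u : ℝ → E}
    (hu : IsIntegralCurveOn u (fun _ => f) (Set.Ici 0)) {C s a : ℝ} (hs : 0 ≤ s) (ha : 0 ≤ a)
    (hC : ∀ t ∈ Set.Icc s (s + a), ‖f (u t)‖ ≤ C) :
    ‖u (s + a) - u s - a • f (u s)‖ ≤ a * (L * C * a) := by
  have hsub : Set.Icc s (s + a) ⊆ Set.Ici 0 := fun t ht => hs.trans ht.1
  have hu' : ∀ t ∈ Set.Icc s (s + a), HasDerivWithinAt u (f (u t)) (Set.Icc s (s + a)) t :=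
    fun t ht => (hu t (hsub ht)).mono hsub
  have h1 : ∀ t ∈ Set.Icc s (s + a), ‖u t - u s‖ ≤ C * (t - s) :=
    norm_image_sub_le_of_norm_deriv_le_segment' hu' fun t ht => hC t ⟨ht.1, ht.2.le⟩
  have hC0 : 0 ≤ C := (norm_nonneg _).trans (hC s ⟨le_rfl, by linarith⟩)
  -- Mean value inequality for the curve minus the line of slope `f (u s)`.
  have h2 := norm_image_sub_le_of_norm_deriv_le_segment' (f := fun t => u t - t • f (u s))
    (f' := fun t => f (u t) - f (u s)) (C := L * (C * a)) (a := s) (b := s + a)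
    (fun t ht => (hu' t ht).sub (by
      simpa using (hasDerivWithinAt_id t _).smul_const (f (u s))))
    (fun t ht => by
      calc ‖f (u t) - f (u s)‖ ≤ L * ‖u t - u s‖ := hf.norm_sub_le _ _
        _ ≤ L * (C * (t - s)) := by gcongr; exact h1 t ⟨ht.1, ht.2.le⟩
        _ ≤ L * (C * a) := by gcongr; linarith [ht.2])
    (s + a) ⟨by linarith, le_rfl⟩
  have e : u (s + a) - (s + a) • f (u s) - (u s - s • f (u s))
      = u (s + a) - u s - a • f (u s) := by module
  simp only [e] at h2
  calc _ ≤ _ := h2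
    _ = _ := by ring

/-- A perturbed Euler scheme for a Lipschitz vector field with a globally asymptotically stable
equilibrium, started in a bounded set, is close to the equilibrium after a suitable time, provided
the steps and the partial sums of the perturbation are small. -/
theorem IsGASEquilibrium.exists_euler_tracking {E : Type*} [NormedAddCommGroup E]
    [NormedSpace ℝ E] [ProperSpace E] {f : E → E} {e : E} (h : IsGASEquilibrium f e) {L : ℝ≥0}
    (hf : LipschitzWith L f) {r : ℝ} (hr : 0 ≤ r) {δ : ℝ} (hδ : 0 < δ) :
    ∃ T > 0, ∃ ε > 0, ∀ (a : ℕ → ℝ) (y g : ℕ → E) (m n : ℕ), m ≤ n →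
      (∀ k, m ≤ k → k < n → 0 ≤ a k ∧ a k ≤ ε) →
      T ≤ ∑ k ∈ Finset.Ico m n, a k → ∑ k ∈ Finset.Ico m n, a k ≤ T + 1 → ‖y m‖ ≤ r →
      (∀ k, m ≤ k → k < n → y (k + 1) = y k + a k • f (y k) + g k) →
      (∀ k, m ≤ k → k ≤ n → ‖∑ i ∈ Finset.Ico m k, g i‖ ≤ ε) → ‖y n - e‖ ≤ δ := by
  obtain ⟨T, hT, hatt⟩ := h.uniform_attraction hf r (half_pos hδ)
  -- `C` bounds the speed of the exact solution on `[0, T + 1]`. `Q` is the Grönwall amplification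
  -- of the errors, so `ε = δ / (2 * Q)` leaves `δ / 2` for the scheme and `δ / 2` for the
  -- attraction.
  set C : ℝ := L * ((r + ‖e‖) * Real.exp (L * (T + 1))) with hCdef
  have hC0 : 0 ≤ C := by positivity
  set Q : ℝ := (1 + L * C * (T + 1)) * Real.exp (L * (T + 1)) with hQdef
  have hQ : 0 < Q := by positivity
  refine ⟨T, hT, δ / (2 * Q), by positivity, ?_⟩
  set ε := δ / (2 * Q) with hεdef
  have hε : 0 < ε := by positivity
  intro a y g m n hmn ha hTn hnT hym hy hg
  obtain ⟨u, hu0, hu⟩ := h.exists_solution (y m)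
  set τ : ℕ → ℝ := fun k => ∑ i ∈ Finset.Ico m k, a i with hτ
  have hτmono : ∀ k, m ≤ k → k ≤ n → 0 ≤ τ k ∧ τ k ≤ T + 1 := by
    intro k hk hkn
    constructor
    · exact Finset.sum_nonneg fun i hi => by
        rw [Finset.mem_Ico] at hi
        exact (ha i hi.1 (by omega)).1
    · refine le_trans ?_ hnT
      refine Finset.sum_le_sum_of_subset_of_nonneg (Finset.Ico_subset_Ico_right hkn) ?_
      intro i hi _
      rw [Finset.mem_Ico] at hi
      exact (ha i hi.1 hi.2).1
  have hbound : ∀ t, 0 ≤ t → t ≤ T + 1 → ‖f (u t)‖ ≤ C := by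
    intro t ht htT
    have h1 := hu.dist_le_mul_exp hf h.isIntegralCurveOn_const ht
    rw [dist_eq_norm, dist_eq_norm, hu0] at h1
    calc ‖f (u t)‖ = ‖f (u t) - f e‖ := by rw [h.equilibrium, sub_zero]
      _ ≤ L * ‖u t - e‖ := hf.norm_sub_le _ _
      _ ≤ L * ((r + ‖e‖) * Real.exp (L * (T + 1))) := by
          gcongr
          refine h1.trans ?_
          have : ‖y m - e‖ ≤ r + ‖e‖ := (norm_sub_le _ _).trans (by gcongr)
          gcongr
  have hτs : ∀ k, m ≤ k → τ (k + 1) = τ k + a k := fun k hk => Finset.sum_Ico_succ_top hk _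
  have hloc : ∀ k, m ≤ k → k < n →
      ‖u (τ (k + 1)) - u (τ k) - a k • f (u (τ k))‖ ≤ a k * (L * C * ε) := by
    intro k hk hkn
    have h1 := hτmono k hk hkn.le
    have h2 := hτmono (k + 1) (by omega) hkn
    have h3 := ha k hk hkn
    rw [hτs k hk] at h2 ⊢
    refine (hu.norm_euler_step_le hf h1.1 h3.1
      (fun t ht => hbound t (h1.1.trans ht.1) (ht.2.trans h2.2))).trans ?_
    gcongr
    · exact h3.1
    · exact h3.2
  -- The perturbation stays in one sum here: only its partial sums are small, not the sums of the
  -- norms of its terms.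
  have hid : ∀ k, m ≤ k → k ≤ n → y k - u (τ k) = ∑ i ∈ Finset.Ico m k, g i
      + ∑ i ∈ Finset.Ico m k, (a i • (f (y i) - f (u (τ i)))
        - (u (τ (i + 1)) - u (τ i) - a i • f (u (τ i)))) := by
    intro k hk
    induction k, hk using Nat.le_induction with
    | base => intro _; simp [hτ, hu0]
    | succ k hk ih =>
      intro hkn
      rw [Finset.sum_Ico_succ_top hk, Finset.sum_Ico_succ_top hk, hy k hk hkn]
      have ih' := ih (by omega)
      rw [add_add_add_comm, ← ih']
      module
  have hD : ∀ k, m ≤ k → k ≤ n → ‖y k - u (τ k)‖ ≤ ε * (1 + L * C * (T + 1))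
      + ∑ i ∈ Finset.Ico m k, (L * a i) * ‖y i - u (τ i)‖ := by
    intro k hk hkn
    rw [hid k hk hkn]
    have h2 : ‖∑ i ∈ Finset.Ico m k, (a i • (f (y i) - f (u (τ i)))
        - (u (τ (i + 1)) - u (τ i) - a i • f (u (τ i))))‖
        ≤ ∑ i ∈ Finset.Ico m k, ((L * a i) * ‖y i - u (τ i)‖ + a i * (L * C * ε)) := by
      refine norm_sum_le_of_le _ fun i hi => ?_
      rw [Finset.mem_Ico] at hi
      refine (norm_sub_le _ _).trans (add_le_add ?_ (hloc i hi.1 (by omega)))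
      rw [norm_smul, Real.norm_of_nonneg (ha i hi.1 (by omega)).1]
      have h4 := hf.norm_sub_le (y i) (u (τ i))
      have h5 := (ha i hi.1 (by omega)).1
      calc a i * ‖f (y i) - f (u (τ i))‖ ≤ a i * (L * ‖y i - u (τ i)‖) := by gcongr
        _ = _ := by ring
    rw [Finset.sum_add_distrib, ← Finset.sum_mul] at h2
    have h6 : (∑ i ∈ Finset.Ico m k, a i) * (L * C * ε) ≤ (T + 1) * (L * C * ε) := by
      gcongr
      exact (hτmono k hk hkn).2
    have h7 := norm_add_le (∑ i ∈ Finset.Ico m k, g i)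
      (∑ i ∈ Finset.Ico m k, (a i • (f (y i) - f (u (τ i)))
        - (u (τ (i + 1)) - u (τ i) - a i • f (u (τ i)))))
    have h8 := hg k hk hkn
    linarith
  have hDn := le_mul_exp_sum_of_le_add_sum (D := fun k => ‖y k - u (τ k)‖)
    (c := fun k => L * a k) (by positivity) hmn
    (fun k hk hkn => mul_nonneg L.2 (ha k hk hkn).1) hD
  have h9 : ‖y n - u (τ n)‖ ≤ δ / 2 := by
    refine hDn.trans ?_
    rw [← Finset.mul_sum]
    calc _ ≤ ε * (1 + L * C * (T + 1)) * Real.exp (L * (T + 1)) := by gcongr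
      _ = ε * Q := by rw [hQdef]; ring
      _ = δ / 2 := by rw [hεdef]; field_simp
  have h10 := hatt u hu (by rwa [hu0]) (τ n) hTn
  calc ‖y n - e‖ = ‖(y n - u (τ n)) + (u (τ n) - e)‖ := by congr 1; abel
    _ ≤ _ := norm_add_le _ _
    _ ≤ δ / 2 + δ / 2 := add_le_add h9 h10.le
    _ = δ := by ring

/-! ### Step sizes and time windows. -/

/-- Step sizes tending to zero with divergent sum: every late index `n` ends a window
of total length between `T` and `T + 1` that starts late. -/
theorem exists_backward_window {a : ℕ → ℝ}
    (hdiv : Tendsto (fun n => ∑ k ∈ Finset.range n, a k) atTop atTop)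
    (ha0 : Tendsto a atTop (𝓝 0)) {T : ℝ} (hT : 0 < T) (n₀ : ℕ) :
    ∃ n₁, ∀ n ≥ n₁, ∃ m, n₀ ≤ m ∧ m ≤ n ∧ T ≤ ∑ k ∈ Finset.Ico m n, a k ∧
      ∑ k ∈ Finset.Ico m n, a k ≤ T + 1 := by
  obtain ⟨n₂, hn₂⟩ := eventually_atTop.1 (ha0.eventually_le_const zero_lt_one)
  set b := max n₀ n₂
  obtain ⟨n₁, hn₁⟩ := eventually_atTop.1
    ((hdiv.eventually_ge_atTop (T + ∑ k ∈ Finset.range b, a k)).and (eventually_ge_atTop b))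
  refine ⟨n₁, fun n hn => ?_⟩
  obtain ⟨h1, hbn⟩ := hn₁ n hn
  have hb : T ≤ ∑ k ∈ Finset.Ico b n, a k := by
    rw [Finset.sum_Ico_eq_sub _ hbn]; linarith
  classical
  -- For the latest admissible start, dropping one step brings the length below `T`, and that step
  -- is at most `1`.
  set m := Nat.findGreatest (fun m => T ≤ ∑ k ∈ Finset.Ico m n, a k) n
  have hbm : b ≤ m := Nat.le_findGreatest hbn hb
  have hmn : m ≤ n := Nat.findGreatest_le n
  have hm : T ≤ ∑ k ∈ Finset.Ico m n, a k :=
    Nat.findGreatest_spec (P := fun m => T ≤ ∑ k ∈ Finset.Ico m n, a k) hbn hb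
  refine ⟨m, (le_max_left _ _).trans hbm, hmn, hm, ?_⟩
  have hlt : m < n := by
    rcases hmn.lt_or_eq with h | h
    · exact h
    · rw [h] at hm
      simp at hm
      linarith
  have h2 : ¬ T ≤ ∑ k ∈ Finset.Ico (m + 1) n, a k :=
    Nat.findGreatest_is_greatest (P := fun m => T ≤ ∑ k ∈ Finset.Ico m n, a k)
      (Nat.lt_succ_self m) hlt
  rw [Finset.sum_eq_sum_Ico_succ_bot hlt]
  have := hn₂ m ((le_max_right _ _).trans hbm)
  linarith

theorem IsStepSizes.tendsto_zero {N : ℕ} {α : Fin N → ℕ → ℝ} (hα : IsStepSizes α) (j : Fin N) :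
    Tendsto (α j) atTop (𝓝 0) := by
  have h1 : Tendsto (fun n => α j n ^ 2) atTop (𝓝 0) :=
    squeeze_zero (fun n => sq_nonneg _)
      (fun n => Finset.single_le_sum (f := fun j => α j n ^ 2) (fun _ _ => sq_nonneg _)
        (Finset.mem_univ j)) hα.summable_sq.tendsto_atTop_zero
  have h2 := h1.sqrt
  simpa [Real.sqrt_sq (hα.pos j _).le] using h2

theorem IsStepSizes.summable_sq_apply {N : ℕ} {α : Fin N → ℕ → ℝ} (hα : IsStepSizes α)
    (j : Fin N) : Summable (fun n => α j n ^ 2) :=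
  hα.summable_sq.of_nonneg_of_le (fun _ => sq_nonneg _) fun n =>
    Finset.single_le_sum (f := fun j => α j n ^ 2) (fun _ _ => sq_nonneg _) (Finset.mem_univ j)

theorem IsStepSizes.tendsto_ratio {N : ℕ} {α : Fin N → ℕ → ℝ} (hα : IsStepSizes α)
    {i l : Fin N} (hil : i < l) : Tendsto (fun n => α l n / α i n) atTop (𝓝 0) := by
  obtain ⟨l, hl⟩ := l
  induction l with
  | zero => exact absurd hil (by simp [Fin.lt_def])
  | succ l ih =>
    have hl' : l < N := by omega
    have hstep := hα.ratio ⟨l, hl'⟩ ⟨l + 1, hl⟩ rfl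
    rcases (Nat.lt_succ_iff.1 (Fin.lt_def.1 hil)).lt_or_eq with h | h
    · have h1 := hstep.mul (ih hl' (Fin.lt_def.2 h))
      rw [mul_zero] at h1
      refine h1.congr fun n => ?_
      have := (hα.pos ⟨l, hl'⟩ n).ne'
      field_simp
    · have : i = ⟨l, hl'⟩ := Fin.ext h
      rwa [this]

theorem IsStepSizes.eventually_le_mul {N : ℕ} {α : Fin N → ℕ → ℝ} (hα : IsStepSizes α)
    {i l : Fin N} (hil : i < l) {κ : ℝ} (hκ : 0 < κ) : ∀ᶠ n in atTop, α l n ≤ κ * α i n := by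
  filter_upwards [(hα.tendsto_ratio hil).eventually_le_const hκ] with n hn
  rwa [div_le_iff₀ (hα.pos i n)] at hn

/-! ### Cascades and scaled drifts. -/

/-- A bound for a finite sequence controlled, up to a factor, by its later entries. -/
theorem Fin.le_mul_pow_of_le_add_mul {N : ℕ} {e : Fin N → ℝ} {δ L : ℝ} (hδ : 0 ≤ δ) (hL : 0 ≤ L)
    (h : ∀ j B, 0 ≤ B → (∀ k, j < k → e k ≤ B) → e j ≤ δ + L * B) (j : Fin N) :
    e j ≤ δ * (1 + L) ^ N := by
  have h1 : (1 : ℝ) ≤ 1 + L := by linarith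
  -- Induction on the number of entries from `j` on; the last entry has nothing after it, so `B = 0`
  -- is allowed.
  have key : ∀ s : ℕ, ∀ j : Fin N, N - j.1 ≤ s + 1 → e j ≤ δ * (1 + L) ^ (s + 1) := by
    intro s
    induction s with
    | zero =>
      intro j hj
      have := h j 0 le_rfl (fun k hk => absurd (Fin.lt_def.1 hk) (by omega))
      rw [zero_add, pow_one]
      nlinarith [mul_nonneg hδ hL]
    | succ s ih =>
      intro j hj
      have h2 := h j (δ * (1 + L) ^ (s + 1)) (by positivity)
        (fun k hk => ih k (by have := Fin.lt_def.1 hk; omega))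
      have h3 : δ ≤ δ * (1 + L) ^ (s + 1) := le_mul_of_one_le_right hδ (one_le_pow₀ h1)
      calc e j ≤ _ := h2
        _ ≤ δ * (1 + L) ^ (s + 1) + L * (δ * (1 + L) ^ (s + 1)) := by gcongr
        _ = _ := by ring
  obtain ⟨s, hs⟩ : ∃ s, N = s + 1 := ⟨N - 1, by have := j.2; omega⟩
  have := key s j (by omega)
  rwa [← hs] at this

/-- The components `z⁽ⁱ⁺¹⁾, …, z⁽ᴺ⁾` of a full tuple. -/
abbrev aboveOf {N : ℕ} {d : Fin N → ℕ} (i : Fin N) (z : NState d) : NAbove d i :=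
  fun l => z l.1

/-- The components `z⁽ⁱ⁾, …, z⁽ᴺ⁾` of a full tuple. -/
abbrev fromOf {N : ℕ} {d : Fin N → ℕ} (i : Fin N) (z : NState d) : NFrom d i :=
  fun l => z l.1

theorem NFrom.cons_aboveOf {N : ℕ} {d : Fin N → ℕ} (i : Fin N) (z : NState d) :
    NFrom.cons i (z i) (aboveOf i z) = fromOf i z := by
  funext l
  obtain ⟨l, hl⟩ := l
  rcases hl.lt_or_eq with h | rfl
  · exact NFrom.cons_of_lt i _ _ l h
  · exact NFrom.cons_self _ _ _

theorem NFrom.norm_cons_sub_cons_le {N : ℕ} {d : Fin N → ℕ} (i : Fin N)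
    (u v : EuclideanSpace ℝ (Fin (d i))) (p q : NAbove d i) :
    ‖NFrom.cons i u p - NFrom.cons i v q‖ ≤ max ‖u - v‖ ‖p - q‖ := by
  refine (pi_norm_le_iff_of_nonneg (by positivity)).2 fun l => ?_
  obtain ⟨l, hl⟩ := l
  rw [Pi.sub_apply]
  rcases hl.lt_or_eq with h | rfl
  · rw [NFrom.cons_of_lt i _ _ l h, NFrom.cons_of_lt i _ _ l h]
    exact (norm_le_pi_norm (p - q) ⟨l, h⟩).trans (le_max_right _ _)
  · rw [NFrom.cons_self, NFrom.cons_self]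
    exact le_max_left _ _

theorem NFrom.lipschitzWith_cons {N : ℕ} {d : Fin N → ℕ} (i : Fin N) (p : NAbove d i) :
    LipschitzWith 1 (fun u => NFrom.cons i u p) :=
  LipschitzWith.of_dist_le_mul fun u v => by
    simpa [dist_eq_norm] using NFrom.norm_cons_sub_cons_le i u v p p

theorem cascade_of_le {N : ℕ} {d : Fin N → ℕ}
    (lam : (i : Fin N) → NAbove d i → EuclideanSpace ℝ (Fin (d i))) {i j : Fin N}
    (y : NFrom d i) (h : i ≤ j) : cascade lam i y j = y ⟨j, h⟩ := by
  rw [cascade, dif_pos h]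

theorem cascade_of_lt {N : ℕ} {d : Fin N → ℕ}
    (lam : (i : Fin N) → NAbove d i → EuclideanSpace ℝ (Fin (d i))) {i j : Fin N}
    (y : NFrom d i) (h : j < i) :
    cascade lam i y j = lam j (aboveOf j (cascade lam i y)) := by
  rw [cascade, dif_neg h.not_ge]

theorem norm_aboveOf_sub_le {N : ℕ} {d : Fin N → ℕ} {j : Fin N} {y z : NState d} {B : ℝ}
    (hB : 0 ≤ B) (h : ∀ k, j < k → ‖y k - z k‖ ≤ B) : ‖aboveOf j y - aboveOf j z‖ ≤ B :=
  (pi_norm_le_iff_of_nonneg hB).2 fun l => h l.1 l.2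

theorem norm_cascade_sub_cascade_le {N : ℕ} {d : Fin N → ℕ}
    {lam : (i : Fin N) → NAbove d i → EuclideanSpace ℝ (Fin (d i))} {L : ℝ≥0}
    (hlam : ∀ i, LipschitzWith L (lam i)) (i : Fin N) (y z : NFrom d i) :
    ‖(cascade lam i y : NState d) - cascade lam i z‖ ≤ ‖y - z‖ * (1 + L) ^ N := by
  refine (pi_norm_le_iff_of_nonneg (by positivity)).2 fun j => ?_
  refine Fin.le_mul_pow_of_le_add_mul
    (e := fun j => ‖((cascade lam i y : NState d) - cascade lam i z) j‖)
    (norm_nonneg (y - z)) L.2 (fun j B hB hk => ?_) j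
  rw [Pi.sub_apply]
  rcases le_or_gt i j with h | h
  · rw [cascade_of_le lam y h, cascade_of_le lam z h]
    have := norm_le_pi_norm (y - z) ⟨j, h⟩
    have h2 : 0 ≤ (L : ℝ) * B := by positivity
    exact this.trans (le_add_of_nonneg_right h2)
  · rw [cascade_of_lt lam y h, cascade_of_lt lam z h]
    have h1 := (hlam j).norm_sub_le (aboveOf j (cascade lam i y)) (aboveOf j (cascade lam i z))
    have h2 := norm_aboveOf_sub_le (y := cascade lam i y) (z := cascade lam i z) hB hk
    calc _ ≤ _ := h1
      _ ≤ L * B := by gcongr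
      _ ≤ _ := le_add_of_nonneg_left (norm_nonneg _)

/-- A tuple whose components below `i` are nearly given by `lam` is close to the cascade of its
remaining components. -/
theorem norm_sub_cascade_le {N : ℕ} {d : Fin N → ℕ}
    {lam : (i : Fin N) → NAbove d i → EuclideanSpace ℝ (Fin (d i))} {L : ℝ≥0}
    (hlam : ∀ i, LipschitzWith L (lam i)) (i : Fin N) {z : NState d} {δ : ℝ} (hδ : 0 ≤ δ)
    (hz : ∀ j < i, ‖z j - lam j (aboveOf j z)‖ ≤ δ) :
    ‖z - cascade lam i (fromOf i z)‖ ≤ δ * (1 + L) ^ N := by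
  refine (pi_norm_le_iff_of_nonneg (by positivity)).2 fun j => ?_
  refine Fin.le_mul_pow_of_le_add_mul
    (e := fun j => ‖(z - cascade lam i (fromOf i z)) j‖) hδ L.2 (fun j B hB hk => ?_) j
  rw [Pi.sub_apply]
  rcases le_or_gt i j with h | h
  · rw [cascade_of_le lam _ h]
    simp only [sub_self, norm_zero]
    exact add_nonneg hδ (mul_nonneg L.2 hB)
  · rw [cascade_of_lt lam _ h]
    have h1 := (hlam j).norm_sub_le (aboveOf j z) (aboveOf j (cascade lam i (fromOf i z)))
    have h2 := norm_aboveOf_sub_le (y := z) (z := cascade lam i (fromOf i z)) hB hk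
    calc _ ≤ ‖z j - lam j (aboveOf j z)‖ + ‖lam j (aboveOf j z)
          - lam j (aboveOf j (cascade lam i (fromOf i z)))‖ := norm_sub_le_norm_sub_add_norm_sub _ _ _
      _ ≤ δ + L * B := add_le_add (hz j h) (h1.trans (by gcongr))

/-- The slowest component is near `0`, and `lam i 0 = 0` with the Lipschitz bound passes smallness
down to the faster ones. This is the source of the final contradiction. -/
theorem norm_le_of_forall_norm_sub_le {N : ℕ} {d : Fin N → ℕ}
    {lam : (i : Fin N) → NAbove d i → EuclideanSpace ℝ (Fin (d i))} {L : ℝ≥0}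
    (hlam : ∀ i, LipschitzWith L (lam i)) (hlam0 : ∀ i, lam i 0 = 0) {z : NState d} {δ : ℝ}
    (hδ : 0 ≤ δ) (hz : ∀ j, ‖z j - lam j (aboveOf j z)‖ ≤ δ) : ‖z‖ ≤ δ * (1 + L) ^ N := by
  refine (pi_norm_le_iff_of_nonneg (by positivity)).2 fun j => ?_
  refine Fin.le_mul_pow_of_le_add_mul (e := fun j => ‖z j‖) hδ L.2 (fun j B hB hk => ?_) j
  have h1 := (hlam j).norm_sub_le (aboveOf j z) 0
  rw [hlam0, sub_zero, sub_zero] at h1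
  have h2 : ‖aboveOf j z‖ ≤ B := (pi_norm_le_iff_of_nonneg hB).2 fun l => hk l.1 l.2
  calc ‖z j‖ = ‖(z j - lam j (aboveOf j z)) + lam j (aboveOf j z)‖ := by congr 1; abel
    _ ≤ _ := norm_add_le _ _
    _ ≤ δ + L * B := add_le_add (hz j) (h1.trans (by gcongr))

/-- The factors `c` and `c⁻¹` cancel, so the estimate is uniform in the scale. -/
theorem norm_scaledDrift_sub_le {N : ℕ} {d : Fin N → ℕ}
    {h : (j : Fin N) → NState d → EuclideanSpace ℝ (Fin (d j))}
    {lam : (i : Fin N) → NAbove d i → EuclideanSpace ℝ (Fin (d i))} {i : Fin N} {Lh : ℝ≥0}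
    (hh : LipschitzWith Lh (h i)) {c : ℝ} (hc : 0 < c) (y : NFrom d i) (z : NState d) :
    ‖c⁻¹ • h i (c • z) - scaledDrift h lam i c y‖ ≤ Lh * ‖z - cascade lam i y‖ := by
  have h1 := hh.norm_sub_le (c • z) (c • (cascade lam i y : NState d))
  rw [← smul_sub, norm_smul, Real.norm_of_nonneg hc.le] at h1
  have e : scaledDrift h lam i c y = c⁻¹ • h i (c • (cascade lam i y : NState d)) := rfl
  rw [e, ← smul_sub, norm_smul, Real.norm_of_nonneg (inv_nonneg.2 hc.le)]
  calc _ ≤ c⁻¹ * (Lh * (c * ‖z - cascade lam i y‖)) := by gcongr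
    _ = _ := by field_simp

/-- The scaled drifts share a Lipschitz constant independent of `c`, which survives pointwise
limits. -/
theorem ScaledCondition.lipschitzWith {N : ℕ} {d : Fin N → ℕ}
    {h : (j : Fin N) → NState d → EuclideanSpace ℝ (Fin (d j))}
    {hInf : (i : Fin N) → NFrom d i → EuclideanSpace ℝ (Fin (d i))}
    {lam : (i : Fin N) → NAbove d i → EuclideanSpace ℝ (Fin (d i))} {i : Fin N}
    (hB : ScaledCondition h hInf lam i) {Lh L : ℝ≥0} (hh : LipschitzWith Lh (h i))
    (hlam : ∀ i, LipschitzWith L (lam i)) : LipschitzWith (Lh * (1 + L) ^ N) (hInf i) := by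
  refine LipschitzWith.of_dist_le_mul fun y z => ?_
  have hlim : ∀ y, Tendsto (fun c : ℝ => scaledDrift h lam i c y) atTop (𝓝 (hInf i y)) :=
    fun y => (hB.limit {y} isCompact_singleton).tendsto_at rfl
  refine le_of_tendsto ((hlim y).dist (hlim z)) ?_
  filter_upwards [eventually_gt_atTop 0] with c hc
  rw [dist_eq_norm, dist_eq_norm]
  calc _ ≤ Lh * ‖(cascade lam i y : NState d) - cascade lam i z‖ :=
        norm_scaledDrift_sub_le (lam := lam) hh hc z (cascade lam i y)
    _ ≤ Lh * (‖y - z‖ * (1 + L) ^ N) := by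
        gcongr
        exact norm_cascade_sub_cascade_le hlam i y z
    _ = _ := by push_cast; ring

/-! ### Deterministic analysis of the rescaled scheme. -/

/-- A deterministic scheme `x_{k+1} = x_k + α_k h(x_k) + w_k` with a nondecreasing bound `R` of the
iterates, relative to which the partial sums of the perturbation `w` are asymptotically
negligible. -/
structure IsPerturbedScheme {N : ℕ} {d : Fin N → ℕ}
    (h : (j : Fin N) → NState d → EuclideanSpace ℝ (Fin (d j))) (α : Fin N → ℕ → ℝ)
    (x w : ℕ → NState d) (R : ℕ → ℝ) : Prop where
  step : ∀ k j, x (k + 1) j = x k j + α j k • h j (x k) + w k j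
  mono : Monotone R
  norm_le : ∀ k, ‖x k‖ ≤ R k
  noise : ∀ j, ∀ ε > 0, ∃ n₀, ∀ a b, n₀ ≤ a → a ≤ b → ‖∑ k ∈ Finset.Ico a b, w k j‖ ≤ ε * R b

theorem IsPerturbedScheme.sub_eq_sum {N : ℕ} {d : Fin N → ℕ}
    {h : (j : Fin N) → NState d → EuclideanSpace ℝ (Fin (d j))} {α : Fin N → ℕ → ℝ}
    {x w : ℕ → NState d} {R : ℕ → ℝ} (hx : IsPerturbedScheme h α x w R) (j : Fin N) {a b : ℕ}
    (hab : a ≤ b) : x b j - x a j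
      = ∑ k ∈ Finset.Ico a b, α j k • h j (x k) + ∑ k ∈ Finset.Ico a b, w k j := by
  rw [← Finset.sum_add_distrib, ← Finset.sum_Ico_sub (fun k => x k j) hab]
  refine Finset.sum_congr rfl fun k _ => ?_
  rw [hx.step]
  abel

/-- The rescaled iterates are eventually close to the graph of `lam i`, uniformly over all scales
above the running bound `R`. -/
def TracksGraph {N : ℕ} {d : Fin N → ℕ}
    (lam : (i : Fin N) → NAbove d i → EuclideanSpace ℝ (Fin (d i)))
    (x : ℕ → NState d) (R : ℕ → ℝ) (i : Fin N) : Prop :=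
  ∀ δ > 0, ∀ᶠ q : ℕ × ℝ in atTop, R q.1 ≤ q.2 →
    ‖(q.2⁻¹ • x q.1) i - lam i (aboveOf i (q.2⁻¹ • x q.1))‖ ≤ δ

theorem norm_inv_smul_le_one {E : Type*} [NormedAddCommGroup E] [NormedSpace ℝ E] {v : E} {ρ : ℝ}
    (hρ : 0 < ρ) (hv : ‖v‖ ≤ ρ) : ‖ρ⁻¹ • v‖ ≤ 1 := by
  rw [norm_smul, norm_inv, Real.norm_of_nonneg hρ.le, inv_mul_le_iff₀ hρ, mul_one]
  exact hv

/-- Components with much smaller step sizes are nearly constant over a window of bounded length. -/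
theorem IsPerturbedScheme.norm_rescaled_sub_le {N : ℕ} {d : Fin N → ℕ}
    {h : (j : Fin N) → NState d → EuclideanSpace ℝ (Fin (d j))} {α : Fin N → ℕ → ℝ}
    {x w : ℕ → NState d} {R : ℕ → ℝ} (hx : IsPerturbedScheme h α x w R) {i l : Fin N}
    (hα : ∀ k, 0 ≤ α l k) {Lh : ℝ≥0} (hh : LipschitzWith Lh (h l)) {H : ℝ} (hH : ‖h l 0‖ ≤ H)
    {κ S ε ρ : ℝ} {k n : ℕ} (hkn : k ≤ n) (hρ : 1 ≤ ρ) (hR : R n ≤ ρ) (hε : 0 ≤ ε) (hκ : 0 ≤ κ)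
    (hratio : ∀ m, k ≤ m → m < n → α l m ≤ κ * α i m) (hS : ∑ m ∈ Finset.Ico k n, α i m ≤ S)
    (hw : ‖∑ m ∈ Finset.Ico k n, w m l‖ ≤ ε * R n) :
    ‖(ρ⁻¹ • x n) l - (ρ⁻¹ • x k) l‖ ≤ κ * S * (Lh + H) + ε := by
  have hρ0 : 0 < ρ := by linarith
  have hH0 : 0 ≤ H := (norm_nonneg _).trans hH
  -- `1 ≤ ρ` absorbs the constant part of the linear growth bound.
  have hdrift : ∀ m, m < n → ‖h l (x m)‖ ≤ (Lh + H) * ρ := by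
    intro m hm
    have h1 := hh.norm_sub_le (x m) 0
    have h2 : ‖x m‖ ≤ ρ := (hx.norm_le m).trans ((hx.mono hm.le).trans hR)
    rw [sub_zero] at h1
    calc ‖h l (x m)‖ = ‖(h l (x m) - h l 0) + h l 0‖ := by congr 1; abel
      _ ≤ ‖h l (x m) - h l 0‖ + ‖h l 0‖ := norm_add_le _ _
      _ ≤ Lh * ρ + H * ρ := by
          refine add_le_add (h1.trans (by gcongr)) (hH.trans ?_)
          exact le_mul_of_one_le_right hH0 hρ
      _ = _ := by ring
  have h1 : ‖∑ m ∈ Finset.Ico k n, α l m • h l (x m)‖ ≤ κ * S * ((Lh + H) * ρ) := by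
    calc _ ≤ ∑ m ∈ Finset.Ico k n, κ * α i m * ((Lh + H) * ρ) := by
          refine norm_sum_le_of_le _ fun m hm => ?_
          rw [Finset.mem_Ico] at hm
          rw [norm_smul, Real.norm_of_nonneg (hα m)]
          have h3 := hratio m hm.1 hm.2
          have h4 := hdrift m hm.2
          exact mul_le_mul h3 h4 (norm_nonneg _) ((hα m).trans h3)
      _ = κ * (∑ m ∈ Finset.Ico k n, α i m) * ((Lh + H) * ρ) := by
          rw [← Finset.sum_mul, ← Finset.mul_sum]
      _ ≤ _ := by gcongr
  have h2 : ‖x n l - x k l‖ ≤ (κ * S * (Lh + H) + ε) * ρ := by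
    rw [hx.sub_eq_sum l hkn]
    refine (norm_add_le _ _).trans ?_
    have : ε * R n ≤ ε * ρ := by gcongr
    linarith
  rw [Pi.smul_apply, Pi.smul_apply, ← smul_sub, norm_smul, norm_inv, Real.norm_of_nonneg hρ0.le,
    inv_mul_le_iff₀ hρ0, mul_comm]
  exact h2

/-- With the slow components frozen at `p`, component `i` is a perturbed Euler scheme for the
limiting ODE with parameter `p`. The threshold for `q` depends on `p`; compactness removes this
dependence later. -/
theorem IsPerturbedScheme.eventually_near_graph_of_near {N : ℕ} {d : Fin N → ℕ}
    {h : (j : Fin N) → NState d → EuclideanSpace ℝ (Fin (d j))} {α : Fin N → ℕ → ℝ}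
    {x w : ℕ → NState d} {R : ℕ → ℝ} (hx : IsPerturbedScheme h α x w R) (hα : IsStepSizes α)
    {Lh L : ℝ≥0} (hh : ∀ j, LipschitzWith Lh (h j))
    {hInf : (i : Fin N) → NFrom d i → EuclideanSpace ℝ (Fin (d i))}
    {lam : (i : Fin N) → NAbove d i → EuclideanSpace ℝ (Fin (d i))}
    (hlam : ∀ i, LipschitzWith L (lam i)) {i : Fin N} (hB : ScaledCondition h hInf lam i)
    (IH : ∀ j < i, TracksGraph lam x R j) {δ : ℝ} (hδ : 0 < δ) (p : NAbove d i) :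
    ∃ η > 0, ∀ᶠ q : ℕ × ℝ in atTop, R q.1 ≤ q.2 → ‖aboveOf i (q.2⁻¹ • x q.1) - p‖ ≤ η →
      ‖(q.2⁻¹ • x q.1) i - lam i (aboveOf i (q.2⁻¹ • x q.1))‖ ≤ δ := by
  set Kf : ℝ≥0 := Lh * (1 + L) ^ N with hKf
  have hInfLip : LipschitzWith Kf (hInf i) := hB.lipschitzWith (hh i) hlam
  have hfLip : LipschitzWith Kf (fun u => hInf i (NFrom.cons i u p)) := by
    simpa [Function.comp_def] using hInfLip.comp (NFrom.lipschitzWith_cons i p)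
  obtain ⟨T, hT, ε, hε, htrack⟩ :=
    (hB.gas p).exists_euler_tracking hfLip zero_le_one (half_pos hδ)
  -- Error budget: a drift error `θ` over a window of length at most `T + 1` costs `ε / 2`, and the
  -- noise costs the other half. The three thirds of `θ` pay for the fast components leaving the
  -- cascade (`δ₁`), for the scaling limit, and for the slow components leaving `p` (at most `2 *
  -- η`). Both `κ` and `ε₂` keep the slow motion within `η`.
  set θ : ℝ := ε / (2 * (T + 1)) with hθ
  have hθ0 : 0 < θ := by positivity
  set η : ℝ := min (θ / (6 * (Kf + 1))) (δ / (2 * (L + 1))) with hη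
  have hη0 : 0 < η := by positivity
  have hη1 : Kf * (2 * η) ≤ θ / 3 := by
    have h1 : η ≤ θ / (6 * (Kf + 1)) := min_le_left _ _
    rw [le_div_iff₀ (by positivity)] at h1
    nlinarith
  have hη2 : L * η ≤ δ / 2 := by
    have h1 : η ≤ δ / (2 * (L + 1)) := min_le_right _ _
    rw [le_div_iff₀ (by positivity)] at h1
    nlinarith
  set δ₁ : ℝ := θ / (3 * (Lh + 1) * (1 + L) ^ N) with hδ₁
  have hδ₁0 : 0 < δ₁ := by positivity
  have hδ₁1 : Lh * (δ₁ * (1 + L) ^ N) ≤ θ / 3 := by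
    have h1 : δ₁ * (1 + L) ^ N = θ / (3 * (Lh + 1)) := by rw [hδ₁]; field_simp
    rw [h1, ← mul_div_assoc, div_le_div_iff₀ (by positivity) (by positivity)]
    nlinarith [hθ0, Lh.2]
  set H : ℝ := ∑ j, ‖h j 0‖ with hH
  have hHj : ∀ j, ‖h j 0‖ ≤ H := fun j =>
    Finset.single_le_sum (f := fun j => ‖h j 0‖) (fun _ _ => norm_nonneg _) (Finset.mem_univ j)
  have hH0 : 0 ≤ H := Finset.sum_nonneg fun _ _ => norm_nonneg _
  set κ : ℝ := η / (2 * (T + 1) * (Lh + H + 1)) with hκ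
  have hκ0 : 0 < κ := by positivity
  have hκ1 : κ * (T + 1) * (Lh + H) ≤ η / 2 := by
    have h1 : κ * (T + 1) * (Lh + H + 1) = η / 2 := by rw [hκ]; field_simp
    nlinarith [mul_pos hκ0 (by linarith : 0 < T + 1)]
  set ε₂ : ℝ := min (ε / 2) (η / 2) with hε₂
  have hε₂0 : 0 < ε₂ := by positivity
  have hIH : ∀ᶠ q : ℕ × ℝ in atTop, ∀ j < i, R q.1 ≤ q.2 →
      ‖(q.2⁻¹ • x q.1) j - lam j (aboveOf j (q.2⁻¹ • x q.1))‖ ≤ δ₁ := by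
    rw [eventually_all]
    intro j
    by_cases hj : j < i
    · filter_upwards [IH j hj δ₁ hδ₁0] with q hq _ using hq
    · exact Eventually.of_forall fun q hq => absurd hq hj
  obtain ⟨⟨nA, cA⟩, hA⟩ := eventually_atTop.1 hIH
  have hlim := Metric.tendstoUniformlyOn_iff.1
    (hB.limit (Metric.closedBall 0 1) (isCompact_closedBall _ _)) (θ / 3) (by positivity)
  obtain ⟨cB, hcB⟩ := eventually_atTop.1 hlim
  have hnoise : ∀ j, ∀ᶠ n₀ in atTop, ∀ a b, n₀ ≤ a → a ≤ b →
      ‖∑ k ∈ Finset.Ico a b, w k j‖ ≤ ε₂ * R b := by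
    intro j
    obtain ⟨n₀, hn₀⟩ := hx.noise j ε₂ hε₂0
    filter_upwards [eventually_ge_atTop n₀] with m hm a b ha hab using hn₀ a b (hm.trans ha) hab
  obtain ⟨nC, hnC⟩ := (eventually_all.2 hnoise).exists
  obtain ⟨nD, hnD⟩ := eventually_atTop.1 ((hα.tendsto_zero i).eventually_le_const hε)
  have hrat : ∀ᶠ n in atTop, ∀ l, i < l → α l n ≤ κ * α i n := by
    rw [eventually_all]
    intro l
    by_cases hl : i < l
    · filter_upwards [hα.eventually_le_mul hl hκ0] with n hn _ using hn
    · exact Eventually.of_forall fun q hq => absurd hq hl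
  obtain ⟨nE, hnE⟩ := eventually_atTop.1 hrat
  set n₀ := max (max nA nC) (max nD nE) with hn₀
  obtain ⟨n₁, hn₁⟩ := exists_backward_window (hα.sum_eq_top i) (hα.tendsto_zero i) hT n₀
  refine ⟨η, hη0, eventually_atTop.2 ⟨(n₁, max 1 (max cA cB)), ?_⟩⟩
  rintro ⟨n, ρ⟩ ⟨hn, hρ⟩ hRρ hnear
  simp only [max_le_iff] at hn hρ hRρ hnear ⊢
  obtain ⟨hρ1, hρA, hρB⟩ := hρ
  have hρ0 : 0 < ρ := by linarith
  obtain ⟨m, hm0, hmn, hTm, hmT⟩ := hn₁ n hn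
  have hmA : nA ≤ m := ((le_max_left _ _).trans (le_max_left _ _)).trans hm0
  have hmC : nC ≤ m := ((le_max_right _ _).trans (le_max_left _ _)).trans hm0
  have hmD : nD ≤ m := ((le_max_left _ _).trans (le_max_right _ _)).trans hm0
  have hmE : nE ≤ m := ((le_max_right _ _).trans (le_max_right _ _)).trans hm0
  have hsub : ∀ k k', m ≤ k → k ≤ k' → k' ≤ n →
      ∑ a ∈ Finset.Ico k k', α i a ≤ T + 1 := fun k k' hk _ hk' =>
    (Finset.sum_le_sum_of_subset_of_nonneg (Finset.Ico_subset_Ico hk hk')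
      fun a _ _ => (hα.pos i a).le).trans hmT
  have hnorm : ∀ k ≤ n, ‖ρ⁻¹ • x k‖ ≤ 1 := fun k hk =>
    norm_inv_smul_le_one hρ0 ((hx.norm_le k).trans ((hx.mono hk).trans hRρ))
  have hslow : ∀ k, m ≤ k → k ≤ n → ‖aboveOf i (ρ⁻¹ • x k) - p‖ ≤ 2 * η := by
    intro k hk hkn
    have h1 : ‖aboveOf i (ρ⁻¹ • x n) - aboveOf i (ρ⁻¹ • x k)‖ ≤ η := by
      refine norm_aboveOf_sub_le hη0.le fun l hl => ?_
      have h2 := hx.norm_rescaled_sub_le (i := i) (l := l) (fun k => (hα.pos l k).le) (hh l)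
        (hHj l) hkn hρ1 hRρ hε₂0.le hκ0.le
        (fun a ha _ => hnE a (hmE.trans (hk.trans ha)) l hl) (hsub k n hk hkn le_rfl)
        (hnC l k n (hmC.trans hk) hkn)
      have h3 : ε₂ ≤ η / 2 := min_le_right _ _
      linarith
    calc _ = ‖(aboveOf i (ρ⁻¹ • x n) - p)
          - (aboveOf i (ρ⁻¹ • x n) - aboveOf i (ρ⁻¹ • x k))‖ := by congr 1; abel
      _ ≤ _ := norm_sub_le _ _
      _ ≤ 2 * η := by linarith
  have hdrift : ∀ k, m ≤ k → k ≤ n →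
      ‖ρ⁻¹ • h i (x k) - hInf i (NFrom.cons i ((ρ⁻¹ • x k) i) p)‖ ≤ θ := by
    intro k hk hkn
    set z : NState d := ρ⁻¹ • x k with hz
    have hxz : x k = ρ • z := by rw [hz, smul_inv_smul₀ hρ0.ne']
    have h1 : ‖ρ⁻¹ • h i (x k) - scaledDrift h lam i ρ (fromOf i z)‖ ≤ θ / 3 := by
      rw [hxz]
      refine (norm_scaledDrift_sub_le (hh i) hρ0 _ _).trans ?_
      -- The induction hypothesis is used at time `k` with the scale `ρ` of the later time `n`;
      -- hence `TracksGraph` covers all scales above `R k`.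
      have h2 := norm_sub_cascade_le hlam i (z := z) hδ₁0.le (fun j hj =>
        hA (k, ρ) ⟨hmA.trans hk, hρA⟩ j hj ((hx.mono hkn).trans hRρ))
      exact le_trans (by gcongr) hδ₁1
    have h2 : ‖hInf i (fromOf i z) - scaledDrift h lam i ρ (fromOf i z)‖ ≤ θ / 3 := by
      rw [← dist_eq_norm]
      refine (hcB ρ hρB (fromOf i z) ?_).le
      rw [mem_closedBall_zero_iff]
      exact (pi_norm_le_iff_of_nonneg zero_le_one).2 fun l =>
        (norm_le_pi_norm z l.1).trans (hnorm k hkn)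
    have h3 : ‖hInf i (fromOf i z) - hInf i (NFrom.cons i (z i) p)‖ ≤ θ / 3 := by
      rw [← NFrom.cons_aboveOf]
      refine (hInfLip.norm_sub_le _ _).trans (le_trans ?_ hη1)
      gcongr
      refine (NFrom.norm_cons_sub_cons_le _ _ _ _ _).trans ?_
      rw [sub_self, norm_zero]
      exact max_le (by positivity) (hslow k hk hkn)
    calc _ = ‖(ρ⁻¹ • h i (x k) - scaledDrift h lam i ρ (fromOf i z))
          - (hInf i (fromOf i z) - scaledDrift h lam i ρ (fromOf i z))
          + (hInf i (fromOf i z) - hInf i (NFrom.cons i (z i) p))‖ := by congr 1; abel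
      _ ≤ _ := norm_add_le _ _
      _ ≤ (θ / 3 + θ / 3) + θ / 3 := add_le_add ((norm_sub_le _ _).trans (add_le_add h1 h2)) h3
      _ = θ := by ring
  have hfinal := htrack (α i) (fun k => (ρ⁻¹ • x k) i)
    (fun k => α i k • (ρ⁻¹ • h i (x k) - hInf i (NFrom.cons i ((ρ⁻¹ • x k) i) p))
      + ρ⁻¹ • w k i) m n hmn
    (fun k hk _ => ⟨(hα.pos i k).le, hnD k (hmD.trans hk)⟩) hTm hmT
    ((norm_le_pi_norm _ i).trans (hnorm m hmn))
    (fun k _ _ => by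
      simp only [Pi.smul_apply]
      rw [hx.step]
      module)
    (fun k hk hkn => by
      rw [Finset.sum_add_distrib, ← Finset.smul_sum]
      have h1 : ‖∑ a ∈ Finset.Ico m k, α i a •
          (ρ⁻¹ • h i (x a) - hInf i (NFrom.cons i ((ρ⁻¹ • x a) i) p))‖ ≤ (T + 1) * θ := by
        calc _ ≤ ∑ a ∈ Finset.Ico m k, α i a * θ := by
              refine norm_sum_le_of_le _ fun a ha => ?_
              rw [Finset.mem_Ico] at ha
              rw [norm_smul, Real.norm_of_nonneg (hα.pos i a).le]
              have := (hα.pos i a).le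
              gcongr
              exact hdrift a ha.1 (by omega)
          _ ≤ _ := by
              rw [← Finset.sum_mul]
              gcongr
              exact hsub m k le_rfl hk hkn
      have h2 : ‖ρ⁻¹ • ∑ a ∈ Finset.Ico m k, w a i‖ ≤ ε / 2 := by
        rw [norm_smul, norm_inv, Real.norm_of_nonneg hρ0.le, inv_mul_le_iff₀ hρ0]
        refine (hnC i m k hmC hk).trans ?_
        rw [mul_comm]
        exact mul_le_mul_of_nonneg ((hx.mono hkn).trans hRρ) (min_le_left _ _)
          ((norm_nonneg _).trans (hx.norm_le k)) (by positivity)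
      have h3 : (T + 1) * θ = ε / 2 := by rw [hθ]; field_simp
      refine (norm_add_le _ _).trans ?_
      linarith)
  have hlp : ‖lam i p - lam i (aboveOf i (ρ⁻¹ • x n))‖ ≤ δ / 2 := by
    refine ((hlam i).norm_sub_le _ _).trans (le_trans ?_ hη2)
    rw [norm_sub_rev]
    gcongr
  calc _ ≤ ‖(ρ⁻¹ • x n) i - lam i p‖ + ‖lam i p - lam i (aboveOf i (ρ⁻¹ • x n))‖ :=
        norm_sub_le_norm_sub_add_norm_sub _ _ _
    _ ≤ δ / 2 + δ / 2 := add_le_add hfinal hlp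
    _ = δ := by ring

/-- Strong induction from the fastest timescale. The rescaled slow components lie in the unit ball,
so finitely many frozen parameters `p` suffice. -/
theorem IsPerturbedScheme.tracksGraph {N : ℕ} {d : Fin N → ℕ}
    {h : (j : Fin N) → NState d → EuclideanSpace ℝ (Fin (d j))} {α : Fin N → ℕ → ℝ}
    {x w : ℕ → NState d} {R : ℕ → ℝ} (hx : IsPerturbedScheme h α x w R) (hα : IsStepSizes α)
    {Lh L : ℝ≥0} (hh : ∀ j, LipschitzWith Lh (h j))
    {hInf : (i : Fin N) → NFrom d i → EuclideanSpace ℝ (Fin (d i))}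
    {lam : (i : Fin N) → NAbove d i → EuclideanSpace ℝ (Fin (d i))}
    (hlam : ∀ i, LipschitzWith L (lam i)) (hB : ∀ i, ScaledCondition h hInf lam i) (i : Fin N) :
    TracksGraph lam x R i := by
  induction i using WellFoundedLT.induction with
  | ind i IH =>
    intro δ hδ
    choose η hη hnear using fun p =>
      hx.eventually_near_graph_of_near hα hh hlam (hB i) IH hδ p
    obtain ⟨s, -, hs⟩ := (isCompact_closedBall (0 : NAbove d i) 1).elim_nhds_subcover
      (fun p => Metric.ball p (η p)) (fun p _ => Metric.ball_mem_nhds _ (hη p))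
    have hall := (Finset.eventually_all s).2 fun p _ => hnear p
    filter_upwards [hall, eventually_ge_atTop ((0, 1) : ℕ × ℝ)] with q hq hq1 hR
    have hq0 : 0 < q.2 := lt_of_lt_of_le one_pos hq1.2
    have hnorm := norm_inv_smul_le_one hq0 ((hx.norm_le q.1).trans hR)
    have hmem : aboveOf i (q.2⁻¹ • x q.1) ∈ Metric.closedBall (0 : NAbove d i) 1 := by
      rw [mem_closedBall_zero_iff]
      exact (pi_norm_le_iff_of_nonneg zero_le_one).2 fun l =>
        (norm_le_pi_norm (q.2⁻¹ • x q.1) l.1).trans hnorm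
    have hcov := hs hmem
    simp only [Set.mem_iUnion] at hcov
    obtain ⟨p, hp, hball⟩ := hcov
    exact hq p hp hR (by rw [← dist_eq_norm]; exact (Metric.mem_ball.1 hball).le)

/-- If every value of `R` is `1` or the norm of an earlier iterate, then the iterates are
bounded. -/
theorem IsPerturbedScheme.bddAbove_norm {N : ℕ} {d : Fin N → ℕ}
    {h : (j : Fin N) → NState d → EuclideanSpace ℝ (Fin (d j))} {α : Fin N → ℕ → ℝ}
    {x w : ℕ → NState d} {R : ℕ → ℝ} (hx : IsPerturbedScheme h α x w R) (hα : IsStepSizes α)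
    (hR : ∀ n, R n = 1 ∨ ∃ k ≤ n, R n = ‖x k‖)
    (hh : ∀ j, ∃ L : ℝ≥0, LipschitzWith L (h j))
    {hInf : (i : Fin N) → NFrom d i → EuclideanSpace ℝ (Fin (d i))}
    {lam : (i : Fin N) → NAbove d i → EuclideanSpace ℝ (Fin (d i))}
    (hB : ∀ i, ScaledCondition h hInf lam i) : BddAbove (Set.range fun n => ‖x n‖) := by
  obtain ⟨Lh, hLh⟩ : ∃ L : ℝ≥0, ∀ j, LipschitzWith L (h j) := by
    choose L hL using hh
    exact ⟨∑ j, L j, fun j => (hL j).weaken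
      (Finset.single_le_sum (fun _ _ => zero_le) (Finset.mem_univ j))⟩
  obtain ⟨L, hL⟩ : ∃ L : ℝ≥0, ∀ j, LipschitzWith L (lam j) := by
    choose L hL using fun i => (hB i).lipschitz
    exact ⟨∑ j, L j, fun j => (hL j).weaken
      (Finset.single_le_sum (fun _ _ => zero_le) (Finset.mem_univ j))⟩
  -- With this choice, closeness to all graphs forces norm at most `1 / 2`.
  set δ : ℝ := 1 / (2 * (1 + L) ^ N) with hδ
  have hδ0 : 0 < δ := by positivity
  have hev : ∀ᶠ q : ℕ × ℝ in atTop, ∀ i, R q.1 ≤ q.2 →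
      ‖(q.2⁻¹ • x q.1) i - lam i (aboveOf i (q.2⁻¹ • x q.1))‖ ≤ δ :=
    eventually_all.2 fun i => hx.tracksGraph hα hLh hL hB i δ hδ0
  obtain ⟨⟨n₀, c⟩, hq⟩ := eventually_atTop.1 hev
  -- A value `R n > C` is not the default `1`, is an admissible scale, and is attained at an index
  -- `k ≥ n₀`.
  set C : ℝ := max (max 1 c) (R n₀) with hC
  have hC1 : 1 ≤ C := (le_max_left _ _).trans (le_max_left _ _)
  suffices hbd : ∀ n, R n ≤ C from ⟨C, by
    rintro _ ⟨n, rfl⟩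
    exact (hx.norm_le n).trans (hbd n)⟩
  intro n
  by_contra! hn
  rcases hR n with h1 | ⟨k, hkn, hk⟩
  · linarith
  have hRk : R k = R n := le_antisymm (hx.mono hkn) (hk ▸ hx.norm_le k)
  have hkn₀ : n₀ ≤ k := by
    by_contra! hlt
    have := hx.mono hlt.le
    have : R n₀ ≤ C := le_max_right _ _
    linarith
  have hRn0 : 0 < R n := by linarith
  have hcR : c ≤ R n := ((le_max_right 1 c).trans (le_max_left _ _)).trans hn.le
  have h2 := norm_le_of_forall_norm_sub_le hL (fun i => (hB i).map_zero) hδ0.le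
    fun j => hq (k, R n) ⟨hkn₀, hcR⟩ j hRk.le
  have h3 : ‖(R n)⁻¹ • x k‖ = 1 := by
    rw [norm_smul, norm_inv, Real.norm_of_nonneg hRn0.le, ← hk, inv_mul_cancel₀ hRn0.ne']
  have h4 : δ * (1 + L) ^ N = 1 / 2 := by rw [hδ]; field_simp
  simp only [] at h2
  rw [h3, h4] at h2
  norm_num at h2

/-! ### Martingale series with summable second moments. -/

/-- The measures with densities `X` and `condLExp m μ X` agree on `m`, and the integral of an
`m`-measurable `w` sees only this restriction. -/
theorem lintegral_mul_condLExp {Ω : Type*} {m m₀ : MeasurableSpace Ω} (hm : m ≤ m₀)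
    (μ : Measure[m₀] Ω) [SigmaFinite (μ.trim hm)] {w X : Ω → ℝ≥0∞} (hw : Measurable[m] w)
    (hX : Measurable[m₀] X) :
    ∫⁻ ω, w ω * condLExp m μ X ω ∂μ = ∫⁻ ω, w ω * X ω ∂μ := by
  have hw₀ : Measurable[m₀] w := hw.mono hm le_rfl
  have htrim : (μ.withDensity (condLExp m μ X)).trim hm = (μ.withDensity X).trim hm := by
    refine @Measure.ext _ m _ _ fun s hs => ?_
    rw [trim_measurableSet_eq hm hs, trim_measurableSet_eq hm hs, withDensity_apply _ (hm s hs),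
      withDensity_apply _ (hm s hs), setLIntegral_condLExp hm μ X hs]
  have key : ∀ {Y : Ω → ℝ≥0∞}, Measurable[m₀] Y →
      ∫⁻ ω, w ω * Y ω ∂μ = ∫⁻ ω, w ω ∂((μ.withDensity Y).trim hm) := by
    intro Y hY
    rw [lintegral_trim hm hw, lintegral_withDensity_eq_lintegral_mul μ hY hw₀]
    simp only [Pi.mul_apply, mul_comm]
  rw [key (measurable_condLExp' m μ X), key hX, htrim]

/-- Orthogonality of martingale differences: the earlier sum is `ℱ n`-measurable and factors out of
the conditional expectation of the cross term. -/
theorem integral_sq_sum_range_eq {Ω : Type*} {m₀ : MeasurableSpace Ω} {μ : Measure Ω}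
    [IsFiniteMeasure μ] {ℱ : Filtration ℕ m₀} {ξ : ℕ → Ω → ℝ}
    (hmeas : ∀ n, StronglyMeasurable[ℱ (n + 1)] (ξ n)) (hL2 : ∀ n, MemLp (ξ n) 2 μ)
    (hcond : ∀ n, μ[ξ n | ℱ n] =ᵐ[μ] 0) (n : ℕ) :
    ∫ ω, (∑ k ∈ Finset.range n, ξ k ω) ^ 2 ∂μ = ∑ k ∈ Finset.range n, ∫ ω, ξ k ω ^ 2 ∂μ := by
  induction n with
  | zero => simp
  | succ n ih =>
    set S : Ω → ℝ := fun ω => ∑ k ∈ Finset.range n, ξ k ω with hS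
    have hSmeas : StronglyMeasurable[ℱ n] S :=
      Finset.stronglyMeasurable_fun_sum _ fun k hk =>
        (hmeas k).mono (ℱ.mono (Finset.mem_range.1 hk))
    have hSL2 : MemLp S 2 μ := memLp_finsetSum _ fun k _ => hL2 k
    have hprod : Integrable (S * ξ n) μ := hSL2.integrable_mul (hL2 n)
    have hcross : ∫ ω, (S * ξ n) ω ∂μ = 0 := by
      rw [← integral_condExp (ℱ.le n) (f := S * ξ n)]
      refine integral_eq_zero_of_ae ?_
      filter_upwards [condExp_mul_of_stronglyMeasurable_left hSmeas hprod
        ((hL2 n).integrable one_le_two), hcond n] with ω h1 h2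
      rw [h1, Pi.mul_apply, h2]
      simp
    rw [Finset.sum_range_succ, ← ih]
    have e : ∀ ω, (∑ k ∈ Finset.range (n + 1), ξ k ω) ^ 2
        = S ω ^ 2 + 2 * (S * ξ n) ω + ξ n ω ^ 2 := by
      intro ω
      rw [Finset.sum_range_succ, Pi.mul_apply]
      ring
    simp_rw [e]
    have hint : Integrable (fun ω => S ω ^ 2 + 2 * (S * ξ n) ω) μ :=
      hSL2.integrable_sq.add (hprod.const_mul 2)
    rw [integral_add hint (hL2 n).integrable_sq,
      integral_add hSL2.integrable_sq (hprod.const_mul 2), integral_const_mul, hcross]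
    ring

/-- A series of martingale differences with summable second moments converges almost surely. -/
theorem ae_exists_tendsto_sum_of_condExp_eq_zero {Ω : Type*} {m₀ : MeasurableSpace Ω}
    {μ : Measure Ω} [IsFiniteMeasure μ] {ℱ : Filtration ℕ m₀} {ξ : ℕ → Ω → ℝ}
    (hmeas : ∀ n, StronglyMeasurable[ℱ (n + 1)] (ξ n)) {c : ℕ → ℝ} (hc : Summable c)
    (hc0 : ∀ n, 0 ≤ c n) (hL2 : ∀ n, ∫⁻ ω, ‖ξ n ω‖ₑ ^ 2 ∂μ ≤ ENNReal.ofReal (c n))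
    (hcond : ∀ n, μ[ξ n | ℱ n] =ᵐ[μ] 0) :
    ∀ᵐ ω ∂μ, ∃ l, Tendsto (fun n => ∑ k ∈ Finset.range n, ξ k ω) atTop (𝓝 l) := by
  have hmeas₀ : ∀ n, AEStronglyMeasurable (ξ n) μ := fun n =>
    ((hmeas n).mono (ℱ.le _)).aestronglyMeasurable
  have hint : ∀ n, Integrable (fun ω => ξ n ω ^ 2) μ := fun n =>
    ⟨(hmeas₀ n).pow 2, by
      simp only [HasFiniteIntegral, enorm_pow]
      exact (hL2 n).trans_lt ENNReal.ofReal_lt_top⟩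
  have hmem : ∀ n, MemLp (ξ n) 2 μ := fun n => (memLp_two_iff_integrable_sq (hmeas₀ n)).2 (hint n)
  have hsq : ∀ n, ∫ ω, ξ n ω ^ 2 ∂μ ≤ c n := by
    intro n
    rw [integral_eq_lintegral_of_nonneg_ae (Eventually.of_forall fun ω => sq_nonneg _)
      (hint n).aestronglyMeasurable]
    refine ENNReal.toReal_le_of_le_ofReal (hc0 n) ?_
    refine le_trans (le_of_eq ?_) (hL2 n)
    refine lintegral_congr fun ω => ?_
    rw [← enorm_pow, Real.enorm_of_nonneg (sq_nonneg _)]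
  set S : ℕ → Ω → ℝ := fun n ω => ∑ k ∈ Finset.range n, ξ k ω with hS
  have hSmem : ∀ n, MemLp (S n) 2 μ := fun n => memLp_finsetSum _ fun k _ => hmem k
  have hSint : ∀ n, Integrable (S n) μ := fun n => (hSmem n).integrable one_le_two
  have hmart : Martingale S ℱ μ := by
    refine martingale_of_condExp_sub_eq_zero_nat (fun n => ?_) hSint fun n => ?_
    · exact Finset.stronglyMeasurable_fun_sum _ fun k hk =>
        (hmeas k).mono (ℱ.mono (Finset.mem_range.1 hk))
    · have e : S (n + 1) - S n = ξ n := by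
        funext ω
        simp [hS, Finset.sum_range_succ]
      rw [e]
      exact hcond n
  -- The `L¹` bound required for convergence comes from `|s| ≤ 1 + s ^ 2`.
  refine hmart.submartingale.exists_ae_tendsto_of_bdd
    (R := Real.toNNReal (μ.real Set.univ + ∑' n, c n)) fun n => ?_
  rw [eLpNorm_one_eq_lintegral_enorm]
  have hSsq : ∫ ω, S n ω ^ 2 ∂μ ≤ ∑' n, c n := by
    rw [integral_sq_sum_range_eq hmeas hmem hcond]
    exact (Finset.sum_le_sum fun k _ => hsq k).trans (hc.sum_le_tsum _ fun k _ => hc0 k)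
  have hi : Integrable (fun ω => 1 + S n ω ^ 2) μ := (integrable_const 1).add (hSmem n).integrable_sq
  calc ∫⁻ ω, ‖S n ω‖ₑ ∂μ ≤ ∫⁻ ω, ENNReal.ofReal (1 + S n ω ^ 2) ∂μ := by
        refine lintegral_mono fun ω => ?_
        rw [Real.enorm_eq_ofReal_abs]
        refine ENNReal.ofReal_le_ofReal ?_
        nlinarith [sq_abs (S n ω), sq_nonneg (|S n ω| - 1)]
    _ = ENNReal.ofReal (∫ ω, (1 + S n ω ^ 2) ∂μ) :=
        (ofReal_integral_eq_lintegral_ofReal hi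
          (Eventually.of_forall fun ω => by positivity)).symm
    _ ≤ ENNReal.ofReal (μ.real Set.univ + ∑' n, c n) := by
        refine ENNReal.ofReal_le_ofReal ?_
        rw [integral_add (integrable_const 1) (hSmem n).integrable_sq]
        simpa using hSsq
    _ = _ := rfl

/-! ### The running bound and its adaptedness. -/

/-- The running maximum of the norms of a sequence, and of `1`. -/
noncomputable def runningBound {E : Type*} [Norm E] (x : ℕ → E) : ℕ → ℝ
  | 0 => max 1 ‖x 0‖
  | n + 1 => max (runningBound x n) ‖x (n + 1)‖

theorem monotone_runningBound {E : Type*} [Norm E] (x : ℕ → E) : Monotone (runningBound x) :=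
  monotone_nat_of_le_succ fun _ => le_max_left _ _

theorem one_le_runningBound {E : Type*} [Norm E] (x : ℕ → E) (n : ℕ) : 1 ≤ runningBound x n :=
  (le_max_left 1 ‖x 0‖).trans (monotone_runningBound x (Nat.zero_le n))

theorem norm_le_runningBound {E : Type*} [Norm E] (x : ℕ → E) (n : ℕ) :
    ‖x n‖ ≤ runningBound x n := by
  cases n with
  | zero => exact le_max_right _ _
  | succ n => exact le_max_right _ _

theorem runningBound_eq {E : Type*} [Norm E] (x : ℕ → E) (n : ℕ) :
    runningBound x n = 1 ∨ ∃ k ≤ n, runningBound x n = ‖x k‖ := by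
  induction n with
  | zero =>
    rcases max_choice 1 ‖x 0‖ with h | h
    · exact Or.inl h
    · exact Or.inr ⟨0, le_rfl, h⟩
  | succ n ih =>
    rcases max_choice (runningBound x n) ‖x (n + 1)‖ with h | h
    · rcases ih with h1 | ⟨k, hk, h1⟩
      · exact Or.inl (h.trans h1)
      · exact Or.inr ⟨k, by omega, h.trans h1⟩
    · exact Or.inr ⟨n + 1, le_rfl, h⟩

section History

variable {N : ℕ} {d : Fin N → ℕ} {Ω : Type*} {x M : ℕ → Ω → NState d}

theorem history_mono : Monotone (history x M) := by
  intro m n hmn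
  refine sup_le_sup ?_ ?_
  · exact iSup_mono fun i => iSup_mono' fun hi => ⟨hi.trans hmn, le_rfl⟩
  · exact iSup_mono fun i => iSup_mono' fun hi => ⟨⟨hi.1, hi.2.trans hmn⟩, le_rfl⟩

theorem history_le [m₀ : MeasurableSpace Ω] (hx : ∀ n j, Measurable (fun ω => x n ω j))
    (hM : ∀ n j, Measurable (fun ω => M (n + 1) ω j)) (n : ℕ) : history x M n ≤ m₀ := by
  refine sup_le ?_ ?_
  · exact iSup_le fun i => iSup_le fun _ => iSup_le fun j => (hx i j).comap_le
  · refine iSup_le fun i => iSup_le fun hi => iSup_le fun j => ?_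
    obtain ⟨i, rfl⟩ : ∃ i', i = i' + 1 := ⟨i - 1, by omega⟩
    exact (hM i j).comap_le

theorem measurable_history_state {i n : ℕ} (hi : i ≤ n) (j : Fin N) :
    Measurable[history x M n] (fun ω => x i ω j) := by
  refine Measurable.of_comap_le (le_trans ?_ le_sup_left)
  exact le_iSup_of_le i (le_iSup_of_le hi (le_iSup_of_le j le_rfl))

theorem measurable_history_noise (n : ℕ) (j : Fin N) :
    Measurable[history x M (n + 1)] (fun ω => M (n + 1) ω j) := by
  refine Measurable.of_comap_le (le_trans ?_ le_sup_right)
  exact le_iSup_of_le (n + 1) (le_iSup_of_le ⟨by omega, le_rfl⟩ (le_iSup_of_le j le_rfl))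

theorem measurable_runningBound (n : ℕ) :
    Measurable[history x M n] (fun ω => runningBound (fun k => x k ω) n) := by
  have hnorm : ∀ {i n : ℕ}, i ≤ n → Measurable[history x M n] (fun ω => ‖x i ω‖) := by
    intro i n hi
    let _ := history x M n
    have hxi : Measurable (fun ω => x i ω) :=
      measurable_pi_iff.2 fun j => measurable_history_state hi j
    exact hxi.norm
  induction n with
  | zero => exact measurable_const.max (hnorm le_rfl)
  | succ n ih => exact (ih.mono (history_mono (Nat.le_succ n)) le_rfl).max (hnorm le_rfl)

end History

/-! ### Noise relative to the running bound. -/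

theorem one_add_sum_norm_sq_le {N : ℕ} {d : Fin N → ℕ} (x : ℕ → NState d) (n : ℕ) :
    1 + ∑ k, ‖x n k‖ ^ 2 ≤ (1 + N) * runningBound x n ^ 2 := by
  have h1 := one_le_runningBound x n
  have h2 : ∑ k, ‖x n k‖ ^ 2 ≤ ∑ _k : Fin N, runningBound x n ^ 2 :=
    Finset.sum_le_sum fun k _ => by
      gcongr
      exact (norm_le_pi_norm (x n) k).trans (norm_le_runningBound x n)
  simp only [Finset.sum_const, Finset.card_univ, Fintype.card_fin, nsmul_eq_mul] at h2
  nlinarith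

/-- The weight is `ℱ_n`-measurable and cancels the growth of the conditional variance, so no moment
of `x n` is needed. -/
theorem IsMartingaleNoise.lintegral_normalized_le {N : ℕ} {d : Fin N → ℕ} {Ω : Type*}
    [MeasurableSpace Ω] {μ : Measure Ω} [IsProbabilityMeasure μ] {x M : ℕ → Ω → NState d}
    {K : Fin N → ℝ} (hM : IsMartingaleNoise μ x M K)
    (hx : ∀ n j, Measurable (fun ω => x n ω j)) (n : ℕ) (j : Fin N) :
    ∫⁻ ω, ENNReal.ofReal ((runningBound (fun k => x k ω) n)⁻¹ ^ 2) * ‖M (n + 1) ω j‖ₑ ^ 2 ∂μ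
      ≤ ENNReal.ofReal (K j * (1 + N)) := by
  have hle := history_le hx hM.measurable n
  have hw : Measurable[history x M n]
      (fun ω => ENNReal.ofReal ((runningBound (fun k => x k ω) n)⁻¹ ^ 2)) :=
    ((measurable_runningBound n).inv.pow_const 2).ennreal_ofReal
  rw [← lintegral_mul_condLExp hle μ hw ((hM.measurable n j).enorm.pow_const 2)]
  calc _ ≤ ∫⁻ _, ENNReal.ofReal (K j * (1 + N)) ∂μ := by
        refine lintegral_mono_ae ?_
        filter_upwards [hM.condLExp_le n j] with ω hω
        refine (mul_le_mul_right hω _).trans ?_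
        rw [← ENNReal.ofReal_mul (by positivity)]
        refine ENNReal.ofReal_le_ofReal ?_
        have h1 := one_add_sum_norm_sq_le (fun k => x k ω) n
        have h2 := one_le_runningBound (fun k => x k ω) n
        have hK := (hM.const_pos j).le
        set r := runningBound (fun k => x k ω) n
        calc r⁻¹ ^ 2 * (K j * (1 + ∑ k, ‖x n ω k‖ ^ 2))
            ≤ r⁻¹ ^ 2 * (K j * ((1 + N) * r ^ 2)) := by gcongr
          _ = K j * (1 + N) := by field_simp
    _ = _ := by simp

/-- Normalization by the predictable weight preserves the martingale difference property, and the
second moments are dominated by a multiple of `a n ^ 2`. -/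
theorem IsMartingaleNoise.ae_exists_tendsto_sum {N : ℕ} {d : Fin N → ℕ} {Ω : Type*}
    [MeasurableSpace Ω] {μ : Measure Ω} [IsProbabilityMeasure μ] {x M : ℕ → Ω → NState d}
    {K : Fin N → ℝ} (hM : IsMartingaleNoise μ x M K)
    (hx : ∀ n j, Measurable (fun ω => x n ω j)) {a : ℕ → ℝ} (ha : ∀ n, 0 ≤ a n)
    (hsum : Summable fun n => a n ^ 2) (j : Fin N) (i : Fin (d j)) :
    ∀ᵐ ω ∂μ, ∃ l, Tendsto (fun n => ∑ k ∈ Finset.range n,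
      (a k * (runningBound (fun k => x k ω) k)⁻¹) * M (k + 1) ω j i) atTop (𝓝 l) := by
  have hle := history_le hx hM.measurable
  let ℱ : Filtration ℕ _ := ⟨history x M, history_mono, hle⟩
  have hwmeas : ∀ n, Measurable[history x M n]
      (fun ω => a n * (runningBound (fun k => x k ω) n)⁻¹) := fun n =>
    (measurable_runningBound n).inv.const_mul (a n)
  have hcoord : ∀ n, Measurable[history x M (n + 1)] (fun ω => M (n + 1) ω j i) := fun n =>
    (EuclideanSpace.proj (𝕜 := ℝ) i).continuous.measurable.comp (measurable_history_noise n j)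
  have hRpos : ∀ n ω, 0 < runningBound (fun k => x k ω) n := fun n ω =>
    one_pos.trans_le (one_le_runningBound _ n)
  refine ae_exists_tendsto_sum_of_condExp_eq_zero (ℱ := ℱ)
    (ξ := fun k ω => (a k * (runningBound (fun k => x k ω) k)⁻¹) * M (k + 1) ω j i)
    (c := fun n => a n ^ 2 * (K j * (1 + N))) ?_ (hsum.mul_right _) ?_ ?_ ?_
  · intro n
    exact ((((hwmeas n).mono (history_mono (Nat.le_succ n)) le_rfl).mul
      (hcoord n))).stronglyMeasurable
  · intro n
    have := (hM.const_pos j).le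
    positivity
  · intro n
    calc _ ≤ ∫⁻ ω, ENNReal.ofReal (a n ^ 2) *
          (ENNReal.ofReal ((runningBound (fun k => x k ω) n)⁻¹ ^ 2) * ‖M (n + 1) ω j‖ₑ ^ 2) ∂μ := by
          refine lintegral_mono fun ω => ?_
          have h0 := hRpos n ω
          have h1 := mul_nonneg (ha n) (inv_nonneg.2 h0.le)
          rw [← mul_assoc, ← ENNReal.ofReal_mul (sq_nonneg _), ← mul_pow, ENNReal.ofReal_pow h1,
            ← Real.enorm_of_nonneg h1, ← mul_pow, enorm_mul]
          gcongr
          exact enorm_le_iff_norm_le.2 (PiLp.norm_apply_le _ i)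
      _ ≤ _ := by
          rw [lintegral_const_mul' _ _ ENNReal.ofReal_ne_top, ENNReal.ofReal_mul (sq_nonneg _)]
          gcongr
          exact hM.lintegral_normalized_le hx n j
  · intro n
    let π : EuclideanSpace ℝ (Fin (d j)) →L[ℝ] ℝ := EuclideanSpace.proj i
    have hcomp := π.comp_condExp_comm (m := history x M n) (hM.integrable n j)
    have hint : Integrable (fun ω => M (n + 1) ω j i) μ :=
      π.integrable_comp (hM.integrable n j)
    -- As the running bound is at least `1`, the weight is bounded by `a n` and factors out for
    -- merely integrable noise.
    have hpull := condExp_stronglyMeasurable_mul_of_bound (hle n) (μ := μ)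
      (hwmeas n).stronglyMeasurable hint (a n) (Eventually.of_forall fun ω => by
        rw [Real.norm_of_nonneg (mul_nonneg (ha n) (inv_nonneg.2 (hRpos n ω).le))]
        exact mul_le_of_le_one_right (ha n) (inv_le_one_of_one_le₀ (one_le_runningBound _ n)))
    filter_upwards [hpull, hcomp, hM.condExp_eq_zero n j] with ω h1 h2 h3
    refine h1.trans ?_
    rw [Pi.mul_apply]
    have h4 : μ[fun ω => M (n + 1) ω j i | history x M n] ω = 0 := by
      refine h2.symm.trans ?_
      rw [Function.comp_apply, h3]
      simp
    rw [h4, mul_zero, Pi.zero_apply]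

/-- Almost surely, the partial sums of the scaled noise are asymptotically negligible relative to
the running bound of the iterates. -/
theorem IsMartingaleNoise.ae_norm_sum_le {N : ℕ} {d : Fin N → ℕ} {Ω : Type*}
    [MeasurableSpace Ω] {μ : Measure Ω} [IsProbabilityMeasure μ] {x M : ℕ → Ω → NState d}
    {K : Fin N → ℝ} (hM : IsMartingaleNoise μ x M K)
    (hx : ∀ n j, Measurable (fun ω => x n ω j)) {a : ℕ → ℝ} (ha : ∀ n, 0 ≤ a n)
    (hsum : Summable fun n => a n ^ 2) (j : Fin N) :
    ∀ᵐ ω ∂μ, ∀ ε > 0, ∃ n₀, ∀ p q, n₀ ≤ p → p ≤ q →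
      ‖∑ k ∈ Finset.Ico p q, a k • M (k + 1) ω j‖ ≤ ε * runningBound (fun k => x k ω) q := by
  filter_upwards [ae_all_iff.2 fun i => hM.ae_exists_tendsto_sum hx ha hsum j i] with ω hω ε hε
  choose l hl using hω
  set R := runningBound (fun k => x k ω) with hR
  set v : ℕ → EuclideanSpace ℝ (Fin (d j)) := fun k => (a k * (R k)⁻¹) • M (k + 1) ω j with hv
  have hRpos : ∀ n, 0 < R n := fun n => one_pos.trans_le (one_le_runningBound _ n)
  have hconv : Tendsto (fun n => ∑ k ∈ Finset.range n, v k) atTop (𝓝 (WithLp.toLp 2 l)) := by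
    have h1 : Tendsto (fun n => fun i => (∑ k ∈ Finset.range n, v k) i) atTop (𝓝 l) := by
      refine tendsto_pi_nhds.2 fun i => ?_
      simpa [hv] using hl i
    exact ((PiLp.continuous_toLp 2 (fun _ : Fin (d j) => ℝ)).tendsto l).comp h1
  obtain ⟨n₀, hn₀⟩ := Metric.cauchySeq_iff.1 hconv.cauchySeq ε hε
  refine ⟨n₀, fun p q hp hpq => ?_⟩
  have e : ∀ k, a k • M (k + 1) ω j = R k • v k := by
    intro k
    rw [hv, smul_smul, mul_left_comm, mul_inv_cancel₀ (hRpos k).ne', mul_one]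
  simp_rw [e]
  -- The Cauchy property makes the tails of the normalized series small; Abel summation restores the
  -- weights at the cost of `R q`.
  refine norm_sum_Ico_smul_le_of_monotone (monotone_runningBound _) (fun n => (hRpos n).le) hpq ?_
  intro k hk hkq
  have h2 := hn₀ q (hp.trans hpq) k (hp.trans hk)
  rw [dist_eq_norm, ← Finset.sum_Ico_eq_sub _ hkq] at h2
  exact h2.le

/-! ### Almost sure boundedness. -/

theorem theorem3 {N : ℕ} {d : Fin N → ℕ} {Ω : Type*} [MeasurableSpace Ω]
    (μ : Measure Ω) [IsProbabilityMeasure μ]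
    (h : (j : Fin N) → NState d → EuclideanSpace ℝ (Fin (d j)))
    (α : Fin N → ℕ → ℝ) (x M : ℕ → Ω → NState d) (K : Fin N → ℝ)
    (hInf : (i : Fin N) → NFrom d i → EuclideanSpace ℝ (Fin (d i)))
    (lamInf lam : (i : Fin N) → NAbove d i → EuclideanSpace ℝ (Fin (d i)))
    (hx : ∀ n j, Measurable (fun ω => x n ω j))
    (hrec : ∀ n ω j, x (n + 1) ω j = x n ω j + α j n • (h j (x n ω) + M (n + 1) ω j))
    (hA1 : ∀ j, ∃ L : ℝ≥0, LipschitzWith L (h j))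
    (hA2 : IsMartingaleNoise μ x M K)
    (hA3 : IsStepSizes α)
    (hB : ∀ i, ScaledCondition h hInf lamInf i)
    (hC : ∀ i, LimitCondition h lam i) :
    ∀ᵐ ω ∂μ, BddAbove (Set.range fun n => ∑ j, ‖x n ω j‖) := by
  have hnoise := ae_all_iff.2 fun j => hA2.ae_norm_sum_le hx (fun n => (hA3.pos j n).le)
    (hA3.summable_sq_apply j) j
  filter_upwards [hnoise] with ω hω
  have hscheme : IsPerturbedScheme h α (fun n => x n ω)
      (fun n j => α j n • M (n + 1) ω j) (runningBound fun n => x n ω) :=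
    { step := fun k j => by rw [hrec, smul_add, add_assoc]
      mono := monotone_runningBound _
      norm_le := norm_le_runningBound _
      noise := hω }
  obtain ⟨C, hCb⟩ := hscheme.bddAbove_norm hA3 (runningBound_eq _) hA1 hB
  refine ⟨∑ _j : Fin N, C, ?_⟩
  rintro _ ⟨n, rfl⟩
  exact Finset.sum_le_sum fun j _ => (norm_le_pi_norm (x n ω) j).trans (hCb ⟨n, rfl⟩)
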